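/- Let $S\subset\mathbb R^3$ be one of the following surfaces of constant curvature: the Euclidean plane $\{z=1\}$; the open hemisphere $\{x^2+y^2+z^2=1,\ z>0\}$ with the metric induced by the usual inner product; the hyperbolic plane $\{x^2+y^2-z^2=-1,\ z>0\}$ with the metric induced by the Lorentz product $x x'+yy'-zz'$. The geodesics of $S$ are its non-empty intersections with planes through the origin. Let $2\le j\le\infty$. An oval of class $C^j$ is a regular, simple, closed $C^j$ curve $\Gamma\subset S$ that is strictly geodesically convex: every geodesic of $S$ tangent to $\Gamma$ meets $\Gamma$ in exactly one point. Let $\Gamma$ be an oval of class $C^j$ of length $l$, parametrized by arclength $s\in\mathbb R/l\mathbb Z$, and let $\Omega\subset S$ be the region bounded by $\Gamma$, i.e. the set of points of $S\setminus\Gamma$ whose connected component in $S\setminus\Gamma$ is relatively compact in $S$. A particle moves along geodesics inside $\Omega$ with unit speed and is reflected elastically at $\Gamma$: the component of its velocity tangent to $\Gamma$ is kept and the normal component is reversed. If it leaves $\Gamma(s_0)$ into $\Omega$ with a velocity that makes the angle $\psi_0\in(0,\pi)$ with $\Gamma'(s_0)$, let $\Gamma(s_1)$ be its next impact with $\Gamma$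 and $\psi_1$ the angle of its velocity immediately after that impact with $\Gamma'(s_1)$. Then for every $(s_0,\psi_0)$ in the open cylinder $\mathcal C=\mathbb R/l\mathbb Z\times(0,\pi)$ there is exactly one such $(s_1,\psi_1)\in\mathcal C$, and the billiard map $T_\Gamma:\mathcal C\to\mathcal C$, $T_\Gamma(s_0,\psi_0)=(s_1,\psi_1)$, has the following properties: 1. $T_\Gamma$ is a $C^{j-1}$ diffeomorphism of $\mathcal C$ (with $\infty-1=\infty$). 2. $T_\Gamma$ is reversible: $T_\Gamma^{-1}=I\circ T_\Gamma\circ I$, where $I(s,\psi)=(s,\pi-\psi)$. 3. $T_\Gamma$ is a twist map: $\dfrac{\partial s_1}{\partial\psi_0}\neq0$ at every point of $\mathcal C$. 4. $T_\Gamma$ is conservative: it preserves the measure $\sin\psi\,ds\,d\psi$ on $\mathcal C$. -/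

import Mathlib

open Set Filter Topology MeasureTheory

namespace OvalBilliard

/-- The three models: the Euclidean plane, the open hemisphere of the unit sphere,
and the upper sheet of the hyperboloid. -/
inductive Model
  | euclidean
  | spherical
  | hyperbolic

/-- The ambient space `ℝ³` (respectively `ℝ^{2,1}`). -/
abbrev V : Type := Fin 3 → ℝ

/-- The ambient bilinear form: the usual inner product of `ℝ³` for the Euclidean plane and the
sphere, the Lorentz product of `ℝ^{2,1}` for the hyperbolic plane. -/
def form : Model → V → V → ℝ
  | .euclidean, x, y => x 0 * y 0 + x 1 * y 1 + x 2 * y 2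
  | .spherical, x, y => x 0 * y 0 + x 1 * y 1 + x 2 * y 2
  | .hyperbolic, x, y => x 0 * y 0 + x 1 * y 1 - x 2 * y 2

/-- The surface `S ⊂ ℝ³`. -/
def surface : Model → Set V
  | .euclidean => {x | x 2 = 1}
  | .spherical => {x | form .spherical x x = 1 ∧ 0 < x 2}
  | .hyperbolic => {x | form .hyperbolic x x = -1 ∧ 0 < x 2}

/-- The tangent plane of `S` at `p`, as a set of vectors of the ambient space. -/
def tangentPlane : Model → V → Set V
  | .euclidean, _ => {v | v 2 = 0}
  | .spherical, p => {v | form .spherical p v = 0}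
  | .hyperbolic, p => {v | form .hyperbolic p v = 0}

/-- The unit speed geodesic of `S` that starts at `p` with the unit tangent vector `τ`. -/
noncomputable def geodesic : Model → V → V → ℝ → V
  | .euclidean, p, τ => fun t => p + t • τ
  | .spherical, p, τ => fun t => Real.cos t • p + Real.sin t • τ
  | .hyperbolic, p, τ => fun t => Real.cosh t • p + Real.sinh t • τ

/-- The full geodesic of `S` through `p` tangent to `v`: the intersection of `S` with the plane
through the origin spanned by `p` and `v`. -/
def tangentGeodesic (M : Model) (p v : V) : Set V :=
  surface M ∩ (Submodule.span ℝ {p, v} : Submodule ℝ V)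

/-- `Γ`, parametrized by arclength with period (hence total length) `l`, is an oval of class `C^j`
on `S`: a regular, simple, closed curve of class `C^j`, strictly geodesically convex in the
sense that every geodesic tangent to `Γ` meets `Γ` in one point only. -/
structure IsOval (M : Model) (j : ℕ∞) (l : ℝ) (Γ : ℝ → V) : Prop where
  contDiff : ContDiff ℝ j Γ
  mem_surface : ∀ s, Γ s ∈ surface M
  unit_speed : ∀ s, form M (deriv Γ s) (deriv Γ s) = 1
  closed : Function.Periodic Γ l
  simple : InjOn Γ (Ico 0 l)
  strictly_convex : ∀ s, tangentGeodesic M (Γ s) (deriv Γ s) ∩ range Γ = {Γ s}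

/-- The region `Ω` of `S` bounded by `Γ`: the points of `S` off `Γ` whose connected component
in `S \ Γ` is relatively compact in `S`. -/
def region (M : Model) (Γ : ℝ → V) : Set V :=
  {x | x ∈ surface M \ range Γ ∧
    ∃ K ⊆ surface M, IsCompact K ∧ connectedComponentIn (surface M \ range Γ) x ⊆ K}

/-- Reflection of the vector `v` in the line spanned by the unit vector `e`: the component along
`e` is kept and the component normal to `e` is reversed. -/
def reflect (M : Model) (e v : V) : V := (2 * form M v e) • e - v

/-- The open cylinder `ℝ/lℤ × (0, π)`. -/
abbrev Cyl (l : ℝ) : Type := AddCircle l × Ioo (0 : ℝ) Real.pi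

/-- One step of the billiard in `Ω`, from the impact and direction `(s₀, ψ₀)` to the next impact
and direction `(s₁, ψ₁)`. The particle leaves `Γ s₀` with a unit velocity `τ` that makes the
angle `ψ₀` with `Γ'(s₀)`, moves along a geodesic, stays in `Ω` at all times strictly between
`0` and `t`, hits `Γ` at `Γ s₁` at time `t`, and is reflected there elastically; `ψ₁` is the angle
of the reflected velocity with `Γ'(s₁)`. -/
def Step (M : Model) (l : ℝ) (Γ : ℝ → V) (c c' : Cyl l) : Prop :=
  ∃ s₀ s₁ : ℝ, (s₀ : AddCircle l) = c.1 ∧ (s₁ : AddCircle l) = c'.1 ∧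
    ∃ τ ∈ tangentPlane M (Γ s₀), form M τ τ = 1 ∧
      form M τ (deriv Γ s₀) = Real.cos c.2 ∧
      ∃ t : ℝ, 0 < t ∧
        (∀ u ∈ Ioo 0 t, geodesic M (Γ s₀) τ u ∈ region M Γ) ∧
        geodesic M (Γ s₀) τ t = Γ s₁ ∧
        form M (reflect M (deriv Γ s₁) (deriv (geodesic M (Γ s₀) τ) t)) (deriv Γ s₁) =
          Real.cos c'.2

open Classical in
/-- The billiard map `T_Γ`: it sends `(s₀, ψ₀)` to the next impact and direction. (The value is
`c` itself if there is no next impact.) -/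
noncomputable def billiardMap (M : Model) (l : ℝ) (Γ : ℝ → V) (c : Cyl l) : Cyl l :=
  if h : ∃ c', Step M l Γ c c' then h.choose else c

/-- `F` represents `T` near the point `p` of the strip `ℝ × (0, π)`, the universal cover of the
cylinder. Local inverses of the covering are the charts of the cylinder, so `F` is `T` read in
charts. -/
def IsLocalLiftAt {l : ℝ} (T : Cyl l → Cyl l) (F : ℝ × ℝ → ℝ × ℝ) (p : ℝ × ℝ) : Prop :=
  ∀ᶠ q in 𝓝 p, ∀ hq : q.2 ∈ Ioo (0 : ℝ) Real.pi,
    ((F q).1 : AddCircle l) = (T ((q.1 : AddCircle l), ⟨q.2, hq⟩)).1 ∧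
      (F q).2 = (T ((q.1 : AddCircle l), ⟨q.2, hq⟩)).2

/-- `T` is a `C^k` map of the cylinder. -/
def IsCk {l : ℝ} (k : ℕ∞) (T : Cyl l → Cyl l) : Prop :=
  ∀ s : ℝ, ∀ ψ ∈ Ioo (0 : ℝ) Real.pi,
    ∃ F : ℝ × ℝ → ℝ × ℝ, IsLocalLiftAt T F (s, ψ) ∧ ContDiffAt ℝ k F (s, ψ)

/-- `T` is a `C^k` diffeomorphism of the cylinder. -/
def IsCkDiffeo {l : ℝ} (k : ℕ∞) (T : Cyl l → Cyl l) : Prop :=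
  ∃ T' : Cyl l → Cyl l, Function.LeftInverse T' T ∧ Function.RightInverse T' T ∧
    IsCk k T ∧ IsCk k T'

/-- The involution `(s, ψ) ↦ (s, π - ψ)`. -/
noncomputable def flip {l : ℝ} (c : Cyl l) : Cyl l :=
  (c.1, ⟨Real.pi - c.2, by
    have h := c.2.2
    exact ⟨by linarith [h.2], by linarith [h.1]⟩⟩)

/-- `T` is reversible: it is invertible with inverse `I ∘ T ∘ I`, for `I (s, ψ) = (s, π - ψ)`. -/
def IsReversible {l : ℝ} (T : Cyl l → Cyl l) : Prop :=
  Function.LeftInverse (flip ∘ T ∘ flip) T ∧ Function.RightInverse (flip ∘ T ∘ flip) T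

/-- The twist property `∂s₁/∂ψ₀ ≠ 0` at every point. (Any two `C¹` local lifts at a
point differ near it by a constant, so the derivative does not depend on `F`.) -/
def IsTwist {l : ℝ} (T : Cyl l → Cyl l) : Prop :=
  ∀ s : ℝ, ∀ ψ ∈ Ioo (0 : ℝ) Real.pi,
    ∃ F : ℝ × ℝ → ℝ × ℝ, IsLocalLiftAt T F (s, ψ) ∧ ContDiffAt ℝ 1 F (s, ψ) ∧
      deriv (fun u => (F (s, u)).1) ψ ≠ 0

/-- The measure `sin ψ ds dψ` on the cylinder. -/
noncomputable def cylMeasure (l : ℝ) [Fact (0 < l)] : Measure (Cyl l) :=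
  ((volume : Measure (AddCircle l)).prod
      (Measure.comap ((↑) : Ioo (0 : ℝ) Real.pi → ℝ) volume)).withDensity
    fun c => ENNReal.ofReal (Real.sin c.2)

end OvalBilliard

/-! A phase point is an oriented chord. For fixed `s`, let `angleCos M Γ s t` be the cosine of the
angle at `Γ s` between the velocity of `Γ` and the chord to `Γ t`. Its derivative in `t` is
`-chordDensity M Γ s t`, where the density is a positive factor times `height Γ s t * height Γ t s`
(`hasDerivAt_angleCos`). Strict convexity says that `height` vanishes only when the two points
coincide, so by connectedness all other heights share one sign and the density is positive for every
genuine chord (`height_mul_height_pos`). With one-sided limits 1 and -1 at the ends of a period, the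
cosine decreases bijectively from `(s, s + l)` onto `(-1, 1)`: a phase point determines its chord,
and every phase point has one.

In these terms `I ∘ T` exchanges the endpoints of a chord (`billiardMap_chordPhase`), and the four
properties follow. The exchange is an involution, which is reversibility. The inverse function
theorem solves `ψ = arccos (angleCos M Γ s t)` for `t`, which gives smoothness and twist
(`exists_lift`); smoothness of the inverse then comes from reversibility. Finally `sin ψ ds dψ`
becomes `chordDensity ds dt`, which is symmetric in the endpoints, so the exchange preserves it.

It remains to see that open chords run inside `Ω`. No Jordan curve theorem is used: the open chords
fill a subset of `S \ Γ` that is both open and closed there and lies in a compact set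
(`chordCone_inter_subset_region`).

The three geometries are treated together by linear algebra in `ℝ³`: `levelForm` cuts out the
surface and its tangent planes, and `triple p` is the area form of the tangent plane at `p`. -/

namespace OvalBilliard

/-! ### Algebra of the three models -/

/-- The symmetric bilinear form whose level set `{c x x = 1, 0 < x 2}` is the surface. -/
def levelForm : Model → V → V → ℝ
  | .euclidean, x, y => x 2 * y 2
  | .spherical, x, y => x 0 * y 0 + x 1 * y 1 + x 2 * y 2
  | .hyperbolic, x, y => x 2 * y 2 - x 0 * y 0 - x 1 * y 1

/-- The determinant of three vectors of `ℝ³`. -/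
def triple (x y z : V) : ℝ :=
  x 0 * (y 1 * z 2 - y 2 * z 1) - x 1 * (y 0 * z 2 - y 2 * z 0) + x 2 * (y 0 * z 1 - y 1 * z 0)

/-- The component of `q` tangent to the surface at `p`; for `q` on the surface, this vector points
from `p` towards `q` along the geodesic. -/
def toward (M : Model) (p q : V) : V := q - levelForm M p q • p

/-- The squared length of `toward M p q`. -/
def towardSq (M : Model) (p q : V) : ℝ := form M (toward M p q) (toward M p q)

/-- The cosine of the angle at `p` between `e` and the geodesic from `p` to `q`. -/
noncomputable def chordCos (M : Model) (p e q : V) : ℝ :=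
  form M (toward M p q) e / √(towardSq M p q)

lemma form_comm (M : Model) (x y : V) : form M x y = form M y x := by
  cases M <;> simp only [form] <;> ring

lemma form_smul_left (M : Model) (a : ℝ) (x y : V) : form M (a • x) y = a * form M x y := by
  cases M <;> simp only [form, Pi.smul_apply, smul_eq_mul] <;> ring

lemma form_smul_right (M : Model) (a : ℝ) (x y : V) : form M x (a • y) = a * form M x y := by
  rw [form_comm, form_smul_left, form_comm]

lemma form_neg_left (M : Model) (x y : V) : form M (-x) y = -form M x y := by
  cases M <;> simp only [form, Pi.neg_apply] <;> ring

lemma form_sub_left (M : Model) (x y z : V) : form M (x - y) z = form M x z - form M y z := by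
  cases M <;> simp only [form, Pi.sub_apply] <;> ring

lemma levelForm_comm (M : Model) (x y : V) : levelForm M x y = levelForm M y x := by
  cases M <;> simp only [levelForm] <;> ring

lemma levelForm_smul_right (M : Model) (a : ℝ) (x y : V) :
    levelForm M x (a • y) = a * levelForm M x y := by
  cases M <;> simp only [levelForm, Pi.smul_apply, smul_eq_mul] <;> ring

lemma levelForm_smul_left (M : Model) (a : ℝ) (x y : V) :
    levelForm M (a • x) y = a * levelForm M x y := by
  rw [levelForm_comm, levelForm_smul_right, levelForm_comm]

lemma levelForm_sub_right (M : Model) (x y z : V) :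
    levelForm M x (y - z) = levelForm M x y - levelForm M x z := by
  cases M <;> simp only [levelForm, Pi.sub_apply] <;> ring

lemma levelForm_add_right (M : Model) (x y z : V) :
    levelForm M x (y + z) = levelForm M x y + levelForm M x z := by
  cases M <;> simp only [levelForm, Pi.add_apply] <;> ring

lemma mem_surface_iff {M : Model} {x : V} : x ∈ surface M ↔ levelForm M x x = 1 ∧ 0 < x 2 := by
  cases M
  · simp only [surface, levelForm, mem_ofPred_eq]
    constructor
    · intro h; simp [h]
    · rintro ⟨h, h'⟩; nlinarith
  · simp only [surface, levelForm, form, mem_ofPred_eq]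
  · simp only [surface, levelForm, form, mem_ofPred_eq]
    constructor <;> rintro ⟨h, h'⟩ <;> exact ⟨by linarith, h'⟩

lemma mem_tangentPlane_iff {M : Model} {p v : V} (hp : p ∈ surface M) :
    v ∈ tangentPlane M p ↔ levelForm M p v = 0 := by
  cases M
  · have : p 2 = 1 := hp
    simp [tangentPlane, levelForm, this]
  · simp only [tangentPlane, levelForm, form, mem_ofPred_eq]
  · simp only [tangentPlane, levelForm, form, mem_ofPred_eq]
    constructor <;> intro h <;> linarith

/-- A product of two determinants is a Gram determinant. Since `p` is a unit normal to the four
tangent vectors, the 3×3 Gram determinant reduces to its tangential 2×2 block. All later angle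
computations rest on this. -/
lemma gram_eq_triple_mul_triple {M : Model} {p a b u v : V} (hp : p ∈ surface M)
    (ha : levelForm M p a = 0) (hb : levelForm M p b = 0)
    (hu : levelForm M p u = 0) (hv : levelForm M p v = 0) :
    form M a u * form M b v - form M a v * form M b u = triple p a b * triple p u v := by
  cases M
  · have h : p 2 = 1 := hp
    simp only [levelForm, h, one_mul] at ha hb hu hv
    simp only [form, triple, h, ha, hb, hu, hv]
    ring
  · have h := (mem_surface_iff.1 hp).1
    simp only [levelForm] at h ha hb hu hv
    have e : triple p a b * triple p u v =
        (p 0 * p 0 + p 1 * p 1 + p 2 * p 2) *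
          (form .spherical a u * form .spherical b v - form .spherical a v * form .spherical b u)
        - (p 0 * u 0 + p 1 * u 1 + p 2 * u 2) *
          ((p 0 * a 0 + p 1 * a 1 + p 2 * a 2) * form .spherical b v
            - form .spherical a v * (p 0 * b 0 + p 1 * b 1 + p 2 * b 2))
        + (p 0 * v 0 + p 1 * v 1 + p 2 * v 2) *
          ((p 0 * a 0 + p 1 * a 1 + p 2 * a 2) * form .spherical b u
            - form .spherical a u * (p 0 * b 0 + p 1 * b 1 + p 2 * b 2)) := by
      simp only [form, triple]; ring
    rw [e, h, ha, hb, hu, hv]; ring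
  · have h := (mem_surface_iff.1 hp).1
    simp only [levelForm] at h ha hb hu hv
    have e : triple p a b * triple p u v =
        (p 2 * p 2 - p 0 * p 0 - p 1 * p 1) *
          (form .hyperbolic a u * form .hyperbolic b v
            - form .hyperbolic a v * form .hyperbolic b u)
        + (p 2 * u 2 - p 0 * u 0 - p 1 * u 1) *
          ((p 2 * a 2 - p 0 * a 0 - p 1 * a 1) * form .hyperbolic b v
            - form .hyperbolic a v * (p 2 * b 2 - p 0 * b 0 - p 1 * b 1))
        - (p 2 * v 2 - p 0 * v 0 - p 1 * v 1) *
          ((p 2 * a 2 - p 0 * a 0 - p 1 * a 1) * form .hyperbolic b u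
            - form .hyperbolic a u * (p 2 * b 2 - p 0 * b 0 - p 1 * b 1)) := by
      simp only [form, triple]; ring
    rw [e, h, ha, hb, hu, hv]; ring

lemma form_self_pos {M : Model} {p v : V} (hp : p ∈ surface M) (hv : levelForm M p v = 0)
    (h0 : v ≠ 0) : 0 < form M v v := by
  have key : v 0 ≠ 0 ∨ v 1 ≠ 0 ∨ v 2 ≠ 0 := by
    by_contra! h
    exact h0 (funext fun i => by fin_cases i <;> simp [h])
  have hn : ∀ a : ℝ, a ≠ 0 → 0 < a * a := fun a ha => mul_self_pos.2 ha
  have h0 := mul_self_nonneg (v 0)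
  have h1 := mul_self_nonneg (v 1)
  have h2 := mul_self_nonneg (v 2)
  cases M
  · simp only [form]
    rcases key with h | h | h <;> linarith [hn _ h]
  · simp only [form]
    rcases key with h | h | h <;> linarith [hn _ h]
  · obtain ⟨h, hp2⟩ := mem_surface_iff.1 hp
    simp only [levelForm] at h hv
    simp only [form]
    -- Tangency eliminates `p 2 * v 2` and the equation of the hyperboloid eliminates `p 2 * p 2`;
    -- what remains is a sum of squares.
    have e : p 2 * p 2 * (v 0 * v 0 + v 1 * v 1 - v 2 * v 2) =
        v 0 * v 0 + v 1 * v 1 + (p 0 * v 1 - p 1 * v 0) * (p 0 * v 1 - p 1 * v 0) := by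
      linear_combination (v 0 * v 0 + v 1 * v 1) * h -
        (p 2 * v 2 + p 0 * v 0 + p 1 * v 1) * hv
    have hxy : 0 < v 0 * v 0 + v 1 * v 1 := by
      rcases key with h | h | h
      · linarith [hn _ h]
      · linarith [hn _ h]
      · by_contra! hle
        have e0 : v 0 = 0 := mul_self_eq_zero.1 (by linarith)
        have e1 : v 1 = 0 := mul_self_eq_zero.1 (by linarith)
        rw [e0, e1] at hv
        have : p 2 * v 2 = 0 := by linarith
        rcases mul_eq_zero.1 this with h' | h'
        · exact hp2.ne' h'
        · exact h h'
    have : 0 < p 2 * p 2 * (v 0 * v 0 + v 1 * v 1 - v 2 * v 2) := by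
      rw [e]; linarith [mul_self_nonneg (p 0 * v 1 - p 1 * v 0)]
    exact pos_of_mul_pos_right this (by positivity)

lemma levelForm_toward {M : Model} {p : V} (hp : p ∈ surface M) (q : V) :
    levelForm M p (toward M p q) = 0 := by
  rw [toward, levelForm_sub_right, levelForm_smul_right, (mem_surface_iff.1 hp).1]; ring

lemma toward_self {M : Model} {p : V} (hp : p ∈ surface M) : toward M p p = 0 := by
  rw [toward, (mem_surface_iff.1 hp).1, one_smul, sub_self]

lemma triple_toward_toward (M : Model) (p q r : V) :
    triple p (toward M p q) (toward M p r) = triple p q r := by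
  simp only [toward, triple, Pi.sub_apply, Pi.smul_apply, smul_eq_mul]; ring

lemma triple_toward_left (M : Model) (p q u : V) :
    triple p (toward M p q) u = triple p q u := by
  simp only [toward, triple, Pi.sub_apply, Pi.smul_apply, smul_eq_mul]; ring

lemma triple_swap (x y z : V) : triple x z y = -triple x y z := by
  simp only [triple]; ring

lemma triple_rotate (x y z : V) : triple y z x = triple x y z := by
  simp only [triple]; ring

lemma toward_ne_zero {M : Model} {p q : V} (hp : p ∈ surface M) (hq : q ∈ surface M)
    (hpq : p ≠ q) : toward M p q ≠ 0 := by
  intro h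
  obtain ⟨hp1, hp2⟩ := mem_surface_iff.1 hp
  obtain ⟨hq1, hq2⟩ := mem_surface_iff.1 hq
  have e : q = levelForm M p q • p := sub_eq_zero.1 h
  set c := levelForm M p q
  rw [e, levelForm_smul_left, levelForm_smul_right, hp1] at hq1
  have hc : 0 < c := by
    rw [e] at hq2
    exact pos_of_mul_pos_left hq2 hp2.le
  have : c = 1 := by nlinarith
  rw [this, one_smul] at e
  exact hpq e.symm

lemma towardSq_pos {M : Model} {p q : V} (hp : p ∈ surface M) (hq : q ∈ surface M)
    (hpq : p ≠ q) : 0 < towardSq M p q :=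
  form_self_pos hp (levelForm_toward hp q) (toward_ne_zero hp hq hpq)

lemma towardSq_euclidean {p q : V} (hp : p ∈ surface .euclidean) (hq : q ∈ surface .euclidean) :
    towardSq .euclidean p q = (q 0 - p 0) ^ 2 + (q 1 - p 1) ^ 2 := by
  have hp : p 2 = 1 := hp
  have hq : q 2 = 1 := hq
  simp only [towardSq, toward, form, levelForm, Pi.sub_apply, Pi.smul_apply, smul_eq_mul, hp, hq]
  ring

lemma towardSq_spherical {p q : V} (hp : p ∈ surface .spherical) (hq : q ∈ surface .spherical) :
    towardSq .spherical p q = 1 - levelForm .spherical p q ^ 2 := by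
  have hp := (mem_surface_iff.1 hp).1
  have hq := (mem_surface_iff.1 hq).1
  simp only [levelForm] at hp hq
  simp only [towardSq, toward, form, levelForm, Pi.sub_apply, Pi.smul_apply, smul_eq_mul]
  linear_combination hq + (p 0 * q 0 + p 1 * q 1 + p 2 * q 2) ^ 2 * hp

lemma towardSq_hyperbolic {p q : V} (hp : p ∈ surface .hyperbolic)
    (hq : q ∈ surface .hyperbolic) :
    towardSq .hyperbolic p q = levelForm .hyperbolic p q ^ 2 - 1 := by
  have hp := (mem_surface_iff.1 hp).1
  have hq := (mem_surface_iff.1 hq).1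
  simp only [levelForm] at hp hq
  simp only [towardSq, toward, form, levelForm, Pi.sub_apply, Pi.smul_apply, smul_eq_mul]
  linear_combination - hq - (p 2 * q 2 - p 0 * q 0 - p 1 * q 1) ^ 2 * hp

lemma towardSq_comm {M : Model} {p q : V} (hp : p ∈ surface M) (hq : q ∈ surface M) :
    towardSq M p q = towardSq M q p := by
  cases M
  · rw [towardSq_euclidean hp hq, towardSq_euclidean hq hp]; ring
  · rw [towardSq_spherical hp hq, towardSq_spherical hq hp, levelForm_comm]
  · rw [towardSq_hyperbolic hp hq, towardSq_hyperbolic hq hp, levelForm_comm]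

/-- `sin²` of the angle of a chord, multiplied by the squared length of `toward`. -/
lemma towardSq_sub_sq {M : Model} {p e : V} (hp : p ∈ surface M) (he : levelForm M p e = 0)
    (he1 : form M e e = 1) (q : V) :
    towardSq M p q - form M (toward M p q) e ^ 2 = triple p e q ^ 2 := by
  have h := gram_eq_triple_mul_triple hp (levelForm_toward hp q) he (levelForm_toward hp q) he
  rw [he1, form_comm M e, triple_toward_left, triple_swap] at h
  rw [towardSq]
  linear_combination h

lemma abs_chordCos_lt_one {M : Model} {p e q : V} (hp : p ∈ surface M) (hq : q ∈ surface M)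
    (he : levelForm M p e = 0) (he1 : form M e e = 1) (h : p ≠ q → triple p e q ≠ 0) :
    |chordCos M p e q| < 1 := by
  -- For a degenerate chord the cosine is the default value `0 / 0 = 0`, so the bound holds for all
  -- pairs of points.
  by_cases hpq : p = q
  · subst hpq
    simp [chordCos, towardSq, toward_self hp, form_comm, ← zero_smul ℝ p, form_smul_left,
      -zero_smul]
  · have hR := towardSq_pos hp hq hpq
    have h1 := towardSq_sub_sq hp he he1 q
    have h2 : 0 < triple p e q ^ 2 := by have := h hpq; positivity
    rw [chordCos, abs_div, abs_of_pos (Real.sqrt_pos.2 hR), div_lt_one (Real.sqrt_pos.2 hR)]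
    exact Real.lt_sqrt_of_sq_lt (by rw [sq_abs]; linarith)

/-! ### Geodesics -/

/-- The coefficient of the base point in a geodesic. -/
noncomputable def geoCos : Model → ℝ → ℝ
  | .euclidean => fun _ => 1
  | .spherical => Real.cos
  | .hyperbolic => Real.cosh

/-- The coefficient of the initial velocity in a geodesic. -/
noncomputable def geoSin : Model → ℝ → ℝ
  | .euclidean => fun t => t
  | .spherical => Real.sin
  | .hyperbolic => Real.sinh

lemma geodesic_apply (M : Model) (p τ : V) (t : ℝ) :
    geodesic M p τ t = geoCos M t • p + geoSin M t • τ := by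
  cases M <;> simp [geodesic, geoCos, geoSin]

lemma toward_geodesic {M : Model} {p τ : V} (hp : p ∈ surface M) (hτ : levelForm M p τ = 0)
    (t : ℝ) : toward M p (geodesic M p τ t) = geoSin M t • τ := by
  rw [toward, geodesic_apply, levelForm_add_right, levelForm_smul_right, levelForm_smul_right, hτ,
    (mem_surface_iff.1 hp).1, mul_one, mul_zero, add_zero, add_sub_cancel_left]

lemma toward_geodesic_symm {M : Model} {p τ : V} (hp : p ∈ surface M) (hτ : levelForm M p τ = 0)
    (t : ℝ) : toward M (geodesic M p τ t) p = -(geoSin M t • deriv (geodesic M p τ) t) := by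
  have hp1 := (mem_surface_iff.1 hp).1
  have e : levelForm M (geodesic M p τ t) p = geoCos M t := by
    rw [levelForm_comm, geodesic_apply, levelForm_add_right, levelForm_smul_right,
      levelForm_smul_right, hτ, hp1, mul_one, mul_zero, add_zero]
  rw [toward, e]
  cases M
  · have hd : HasDerivAt (geodesic .euclidean p τ) τ t := by
      simpa [geodesic] using ((hasDerivAt_id t).smul_const τ).const_add p
    rw [hd.deriv]
    simp [geodesic, geoCos, geoSin]
  · have hd : HasDerivAt (geodesic .spherical p τ) ((-Real.sin t) • p + Real.cos t • τ) t :=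
      ((Real.hasDerivAt_cos t).smul_const p).add ((Real.hasDerivAt_sin t).smul_const τ)
    rw [hd.deriv]
    ext i
    simp only [geodesic, geoCos, geoSin, Pi.sub_apply, Pi.add_apply, Pi.smul_apply, smul_eq_mul,
      Pi.neg_apply]
    linear_combination -p i * Real.sin_sq_add_cos_sq t
  · have hd : HasDerivAt (geodesic .hyperbolic p τ) (Real.sinh t • p + Real.cosh t • τ) t :=
      ((Real.hasDerivAt_cosh t).smul_const p).add ((Real.hasDerivAt_sinh t).smul_const τ)
    rw [hd.deriv]
    ext i
    simp only [geodesic, geoCos, geoSin, Pi.sub_apply, Pi.add_apply, Pi.smul_apply, smul_eq_mul,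
      Pi.neg_apply]
    linear_combination -p i * Real.cosh_sq_sub_sinh_sq t

/-- The initial velocity of the geodesic from `p` to `q`. -/
noncomputable def direction (M : Model) (p q : V) : V := (√(towardSq M p q))⁻¹ • toward M p q

lemma chordCos_eq (M : Model) (p e q : V) : chordCos M p e q = form M (direction M p q) e := by
  rw [direction, form_smul_left, chordCos, div_eq_inv_mul]

lemma levelForm_direction {M : Model} {p : V} (hp : p ∈ surface M) (q : V) :
    levelForm M p (direction M p q) = 0 := by
  rw [direction, levelForm_smul_right, levelForm_toward hp, mul_zero]

lemma form_direction {M : Model} {p q : V} (hp : p ∈ surface M) (hq : q ∈ surface M)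
    (hpq : p ≠ q) : form M (direction M p q) (direction M p q) = 1 := by
  have h := towardSq_pos hp hq hpq
  have h' := Real.sqrt_pos.2 h
  rw [direction, form_smul_left, form_smul_right, ← towardSq]
  nth_rw 3 [← Real.mul_self_sqrt h.le]
  field_simp

lemma towardSq_geodesic {M : Model} {p τ : V} (hp : p ∈ surface M) (hτ : levelForm M p τ = 0)
    (hτ1 : form M τ τ = 1) (t : ℝ) : towardSq M p (geodesic M p τ t) = geoSin M t ^ 2 := by
  rw [towardSq, toward_geodesic hp hτ, form_smul_left, form_smul_right, hτ1]; ring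

lemma geodesic_data {M : Model} {p τ : V} {t : ℝ} (hp : p ∈ surface M)
    (hτ : levelForm M p τ = 0) (hτ1 : form M τ τ = 1) (ht : 0 < geoSin M t)
    (hq : geodesic M p τ t ∈ surface M) :
    p ≠ geodesic M p τ t ∧ τ = direction M p (geodesic M p τ t) ∧
      deriv (geodesic M p τ) t = -direction M (geodesic M p τ t) p := by
  have hR := towardSq_geodesic hp hτ hτ1 t
  have hs : √(towardSq M p (geodesic M p τ t)) = geoSin M t := by
    rw [hR, Real.sqrt_sq ht.le]
  refine ⟨fun h => ?_, ?_, ?_⟩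
  · have h0 : towardSq M p p = 0 := by
      rw [towardSq, toward_self hp, ← zero_smul ℝ p, form_smul_left, zero_mul]
    rw [← h, h0] at hR
    exact (pow_pos ht 2).ne hR
  · rw [direction, hs, toward_geodesic hp hτ, inv_smul_smul₀ ht.ne']
  · rw [direction, towardSq_comm hq hp, hs, toward_geodesic_symm hp hτ, smul_neg,
      inv_smul_smul₀ ht.ne', neg_neg]

/-- Only the sphere needs an argument: a great circle from `p` is at `-p` at time `π`, outside the
open hemisphere, so the travel time is less than `π`. -/
lemma geoSin_pos_of_mem_surface {M : Model} {p τ : V} {t : ℝ} (hp : p ∈ surface M) (ht : 0 < t)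
    (h : ∀ u ∈ Ioo 0 t, geodesic M p τ u ∈ surface M) (ht' : geodesic M p τ t ∈ surface M) :
    0 < geoSin M t := by
  cases M
  · exact ht
  · refine Real.sin_pos_of_pos_of_lt_pi ht ?_
    by_contra! hle
    have hpi : geodesic .spherical p τ Real.pi ∈ surface .spherical := by
      rcases hle.eq_or_lt with e | hlt
      · rwa [e]
      · exact h _ ⟨Real.pi_pos, hlt⟩
    have h1 := (mem_surface_iff.1 hpi).2
    have h2 := (mem_surface_iff.1 hp).2
    simp [geodesic] at h1
    linarith
  · exact Real.sinh_pos_iff.2 ht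

lemma geodesic_mem {M : Model} {p τ : V} {t : ℝ} (hp : p ∈ surface M)
    (hτ : levelForm M p τ = 0) (hτ1 : form M τ τ = 1) (h : 0 < geodesic M p τ t 2) :
    geodesic M p τ t ∈ surface M := by
  refine mem_surface_iff.2 ⟨?_, h⟩
  have hp1 := (mem_surface_iff.1 hp).1
  have e : levelForm M (geoCos M t • p + geoSin M t • τ) (geoCos M t • p + geoSin M t • τ) =
      geoCos M t ^ 2 * levelForm M p p + 2 * (geoCos M t * geoSin M t) * levelForm M p τ +
        geoSin M t ^ 2 * levelForm M τ τ := by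
    cases M <;> simp only [levelForm, Pi.add_apply, Pi.smul_apply, smul_eq_mul] <;> ring
  rw [geodesic_apply, e, hτ, hp1]
  clear e
  cases M
  · have h1 : p 2 = 1 := hp
    have h2 : τ 2 = 0 := by simpa [levelForm, h1] using hτ
    simp [levelForm, h2, geoCos]
  · have : levelForm .spherical τ τ = 1 := hτ1
    rw [this]
    simp only [geoCos, geoSin]
    linear_combination Real.sin_sq_add_cos_sq t
  · have : levelForm .hyperbolic τ τ = -1 := by
      simp only [form] at hτ1; simp only [levelForm]; linarith
    rw [this]
    simp only [geoCos, geoSin]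
    linear_combination Real.cosh_sq_sub_sinh_sq t

/-- Cauchy–Schwarz in the horizontal plane: vectors in the same open half of the light cone have a
timelike product of one sign. -/
lemma levelForm_hyperbolic_pos {p q : V} (hp : p ∈ surface .hyperbolic)
    (hq : q ∈ surface .hyperbolic) : 0 < levelForm .hyperbolic p q := by
  obtain ⟨hp1, hp2⟩ := mem_surface_iff.1 hp
  obtain ⟨hq1, hq2⟩ := mem_surface_iff.1 hq
  simp only [levelForm] at hp1 hq1 ⊢
  have h : (p 0 * q 0 + p 1 * q 1) ^ 2 < (p 2 * q 2) ^ 2 := by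
    have : (p 2 * q 2) ^ 2 = (1 + p 0 * p 0 + p 1 * p 1) * (1 + q 0 * q 0 + q 1 * q 1) := by
      linear_combination p 2 * p 2 * hq1 + (1 + q 0 * q 0 + q 1 * q 1) * hp1
    rw [this]
    nlinarith [sq_nonneg (p 0 * q 1 - p 1 * q 0), mul_self_nonneg (p 0), mul_self_nonneg (p 1),
      mul_self_nonneg (q 0), mul_self_nonneg (q 1)]
  have := abs_lt_of_sq_lt_sq h (by positivity)
  linarith [(abs_lt.1 this).2]

/-- The length is the Euclidean distance, an `arccos` or an `arsinh`. The last clause is the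
subtraction formula for the generalized sine, which makes the weights of `p` and `q` along the
segment positive in `exists_geodesic`. -/
lemma exists_length {M : Model} {p q : V} (hp : p ∈ surface M) (hq : q ∈ surface M)
    (hpq : p ≠ q) : ∃ t, 0 < t ∧ geoCos M t = levelForm M p q ∧ geoSin M t = √(towardSq M p q) ∧
      ∀ u ∈ Ioo 0 t, 0 < geoSin M u ∧ 0 < geoSin M (t - u) ∧
        geoCos M u * geoSin M t - geoSin M u * geoCos M t = geoSin M (t - u) := by
  have hR := towardSq_pos hp hq hpq
  cases M
  · refine ⟨√(towardSq .euclidean p q), Real.sqrt_pos.2 hR, ?_, rfl, fun u hu => ?_⟩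
    · have h1 : p 2 = 1 := hp
      have h2 : q 2 = 1 := hq
      simp [geoCos, levelForm, h1, h2]
    · exact ⟨hu.1, sub_pos.2 hu.2, by simp [geoCos, geoSin]⟩
  · have e := towardSq_spherical hp hq
    have hc : levelForm .spherical p q ^ 2 < 1 := by linarith
    have hc' := abs_lt.1 ((sq_lt_one_iff_abs_lt_one _).1 hc)
    refine ⟨Real.arccos (levelForm .spherical p q), Real.arccos_pos.2 hc'.2,
      Real.cos_arccos hc'.1.le hc'.2.le, ?_, fun u hu => ⟨?_, ?_, ?_⟩⟩
    · rw [e]; exact Real.sin_arccos _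
    · exact Real.sin_pos_of_pos_of_lt_pi hu.1 (hu.2.trans_le (Real.arccos_le_pi _))
    · exact Real.sin_pos_of_pos_of_lt_pi (sub_pos.2 hu.2)
        (by linarith [hu.1, Real.arccos_le_pi (levelForm .spherical p q)])
    · simp only [geoCos, geoSin, Real.sin_sub]; ring
  · have e := towardSq_hyperbolic hp hq
    have hs := Real.sqrt_pos.2 hR
    refine ⟨Real.arsinh √(towardSq .hyperbolic p q), Real.arsinh_pos_iff.2 hs, ?_,
      Real.sinh_arsinh _, fun u hu => ⟨?_, ?_, ?_⟩⟩
    · have h := levelForm_hyperbolic_pos hp hq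
      simp only [geoCos, Real.cosh_arsinh, Real.sq_sqrt hR.le]
      rw [e, add_sub_cancel, Real.sqrt_sq h.le]
    · exact Real.sinh_pos_iff.2 hu.1
    · exact Real.sinh_pos_iff.2 (sub_pos.2 hu.2)
    · simp only [geoCos, geoSin, Real.sinh_sub]; ring

lemma exists_geodesic {M : Model} {p q : V} (hp : p ∈ surface M) (hq : q ∈ surface M)
    (hpq : p ≠ q) : ∃ t, 0 < t ∧ geodesic M p (direction M p q) t = q ∧
      deriv (geodesic M p (direction M p q)) t = -direction M q p ∧
      ∀ u ∈ Ioo 0 t, geodesic M p (direction M p q) u ∈ surface M ∧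
        ∃ a b : ℝ, 0 < a ∧ 0 < b ∧ geodesic M p (direction M p q) u = a • p + b • q := by
  obtain ⟨t, ht, hc, hs, h⟩ := exists_length hp hq hpq
  have hs' := Real.sqrt_pos.2 (towardSq_pos hp hq hpq)
  have ht' : 0 < geoSin M t := hs ▸ hs'
  have hτ := levelForm_direction hp q
  have hτ1 := form_direction hp hq hpq
  have e : geodesic M p (direction M p q) t = q := by
    rw [geodesic_apply, hc, hs, direction, smul_inv_smul₀ hs'.ne', toward, add_sub_cancel]
  refine ⟨t, ht, e, ?_, fun u hu => ?_⟩
  · have := (geodesic_data hp hτ hτ1 ht' (by rwa [e])).2.2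
    rwa [e] at this
  · obtain ⟨h1, h2, h3⟩ := h u hu
    have e' : geodesic M p (direction M p q) u =
        (geoSin M (t - u) / geoSin M t) • p + (geoSin M u / geoSin M t) • q := by
      rw [geodesic_apply, direction, ← hs, toward, ← hc]
      ext i
      simp only [Pi.add_apply, Pi.smul_apply, Pi.sub_apply, smul_eq_mul]
      rw [← h3]
      field_simp
      ring
    refine ⟨geodesic_mem hp hτ hτ1 ?_, _, _, div_pos h2 ht', div_pos h1 ht', e'⟩
    rw [e']
    have hp2 := (mem_surface_iff.1 hp).2
    have hq2 := (mem_surface_iff.1 hq).2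
    simp only [Pi.add_apply, Pi.smul_apply, smul_eq_mul]
    positivity

/-! ### Ovals -/

/-- The height of `Γ t` over the tangent geodesic at `Γ s`, up to a positive factor. -/
noncomputable def height (Γ : ℝ → V) (s t : ℝ) : ℝ := triple (Γ s) (deriv Γ s) (Γ t)

lemma hasDerivAt_levelForm (M : Model) {f g : ℝ → V} {f' g' : V} {s : ℝ}
    (hf : HasDerivAt f f' s) (hg : HasDerivAt g g' s) :
    HasDerivAt (fun s => levelForm M (f s) (g s))
      (levelForm M f' (g s) + levelForm M (f s) g') s := by
  have hf := hasDerivAt_pi.1 hf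
  have hg := hasDerivAt_pi.1 hg
  cases M
  · exact (hf 2).mul (hg 2)
  · exact ((((hf 0).mul (hg 0)).add ((hf 1).mul (hg 1))).add ((hf 2).mul (hg 2))).congr_deriv
      (by simp only [levelForm]; ring)
  · exact ((((hf 2).mul (hg 2)).sub ((hf 0).mul (hg 0))).sub ((hf 1).mul (hg 1))).congr_deriv
      (by simp only [levelForm]; ring)

lemma hasDerivAt_form (M : Model) {f g : ℝ → V} {f' g' : V} {s : ℝ}
    (hf : HasDerivAt f f' s) (hg : HasDerivAt g g' s) :
    HasDerivAt (fun s => form M (f s) (g s)) (form M f' (g s) + form M (f s) g') s := by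
  have hf := hasDerivAt_pi.1 hf
  have hg := hasDerivAt_pi.1 hg
  cases M
  · exact ((((hf 0).mul (hg 0)).add ((hf 1).mul (hg 1))).add ((hf 2).mul (hg 2))).congr_deriv
      (by simp only [form]; ring)
  · exact ((((hf 0).mul (hg 0)).add ((hf 1).mul (hg 1))).add ((hf 2).mul (hg 2))).congr_deriv
      (by simp only [form]; ring)
  · exact ((((hf 0).mul (hg 0)).add ((hf 1).mul (hg 1))).sub ((hf 2).mul (hg 2))).congr_deriv
      (by simp only [form]; ring)

lemma hasDerivAt_toward (M : Model) (p : V) {f : ℝ → V} {f' : V} {s : ℝ}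
    (hf : HasDerivAt f f' s) : HasDerivAt (fun s => toward M p (f s)) (toward M p f') s := by
  have h := hasDerivAt_levelForm M (hasDerivAt_const s p) hf
  have e : levelForm M 0 (f s) = 0 := by cases M <;> simp [levelForm]
  rw [e, zero_add] at h
  exact hf.sub (h.smul_const p)

section
variable {M : Model} {j : ℕ∞} {l : ℝ} {Γ : ℝ → V}

namespace IsOval

lemma hasDerivAt (hΓ : IsOval M j l Γ) (hj : 1 ≤ j) (s : ℝ) : HasDerivAt Γ (deriv Γ s) s :=
  (hΓ.contDiff.differentiable (by
    intro h
    have : j = 0 := by exact_mod_cast h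
    simp [this] at hj) s).hasDerivAt

lemma contDiff_deriv (hΓ : IsOval M j l Γ) (hj : 1 ≤ j) :
    ContDiff ℝ ((j - 1 : ℕ∞) : WithTop ℕ∞) (deriv Γ) := by
  have e : ((j : ℕ∞) : WithTop ℕ∞) = ((j - 1 : ℕ∞) : WithTop ℕ∞) + 1 := by
    have : j = (j - 1) + 1 := (tsub_add_cancel_of_le hj).symm
    exact_mod_cast this
  have h := hΓ.contDiff
  rw [e, contDiff_succ_iff_deriv] at h
  exact h.2.2

lemma levelForm_deriv (hΓ : IsOval M j l Γ) (hj : 1 ≤ j) (s : ℝ) :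
    levelForm M (Γ s) (deriv Γ s) = 0 := by
  have h := hasDerivAt_levelForm M (hΓ.hasDerivAt hj s) (hΓ.hasDerivAt hj s)
  have e : (fun s => levelForm M (Γ s) (Γ s)) = fun _ => 1 :=
    funext fun s => (mem_surface_iff.1 (hΓ.mem_surface s)).1
  rw [e, levelForm_comm M (deriv Γ s)] at h
  have := h.unique (hasDerivAt_const s 1)
  linarith

lemma periodic_deriv (hΓ : IsOval M j l Γ) : Function.Periodic (deriv Γ) l := by
  intro s
  rw [← deriv_comp_add_const]
  exact congrArg (fun f => deriv f s) (funext hΓ.closed)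

lemma apply_eq_iff (hΓ : IsOval M j l Γ) (hl : 0 < l) {s t : ℝ} :
    Γ s = Γ t ↔ (s : AddCircle l) = t := by
  constructor
  · intro h
    have hs2 : toIcoMod hl 0 s ∈ Ico 0 l := by simpa using toIcoMod_mem_Ico hl 0 s
    have ht2 : toIcoMod hl 0 t ∈ Ico 0 l := by simpa using toIcoMod_mem_Ico hl 0 t
    have e : ∀ r, Γ (toIcoMod hl 0 r) = Γ r := fun r => by
      rw [toIcoMod, hΓ.closed.sub_zsmul_eq]
    have := hΓ.simple hs2 ht2 (by rw [e, e, h])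
    have c : ∀ r : ℝ, ((toIcoMod hl 0 r : ℝ) : AddCircle l) = r := fun r => by
      rw [toIcoMod, AddCircle.coe_sub, AddCircle.coe_zsmul, AddCircle.coe_period]; simp
    rw [← c s, ← c t, this]
  · intro h
    have := congrArg hΓ.closed.lift h
    simpa using this

/-- Zero height is equality in Cauchy–Schwarz, so the chord would leave `Γ s` along the velocity and
`Γ t` would be a second point of `Γ` on the tangent geodesic. -/
lemma height_ne_zero (hΓ : IsOval M j l Γ) (hj : 1 ≤ j) {s t : ℝ} (h : Γ s ≠ Γ t) :
    height Γ s t ≠ 0 := by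
  intro h0
  have hp := hΓ.mem_surface s
  have he := hΓ.levelForm_deriv hj s
  have he1 := hΓ.unit_speed s
  have hq := hΓ.mem_surface t
  have hR := towardSq_pos hp hq h
  have h1 := towardSq_sub_sq hp he he1 (Γ t)
  -- the tangent vector towards `Γ t` is a multiple of the velocity
  have hd : toward M (Γ s) (Γ t) = form M (toward M (Γ s) (Γ t)) (deriv Γ s) • deriv Γ s := by
    by_contra hne
    have hw : levelForm M (Γ s) (toward M (Γ s) (Γ t) -
        form M (toward M (Γ s) (Γ t)) (deriv Γ s) • deriv Γ s) = 0 := by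
      rw [levelForm_sub_right, levelForm_smul_right, levelForm_toward hp, he]; simp
    have := form_self_pos hp hw (sub_ne_zero.2 hne)
    rw [form_sub_left, form_comm, form_sub_left, form_smul_left, form_smul_left,
      form_comm M (deriv Γ s) (_ - _), form_sub_left, form_smul_left, he1,
      form_comm M (deriv Γ s) (toward M _ _)] at this
    change triple _ _ _ = 0 at h0
    rw [h0, towardSq] at h1
    linarith
  have hmem : Γ t ∈ tangentGeodesic M (Γ s) (deriv Γ s) ∩ range Γ := by
    refine ⟨⟨hq, ?_⟩, mem_range_self t⟩
    rw [toward, sub_eq_iff_eq_add] at hd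
    exact Submodule.mem_span_pair.2 ⟨_, _, by rw [add_comm]; exact hd.symm⟩
  rw [hΓ.strictly_convex s] at hmem
  exact h hmem.symm

lemma continuous (hΓ : IsOval M j l Γ) : Continuous Γ := hΓ.contDiff.continuous

lemma continuous_deriv (hΓ : IsOval M j l Γ) (hj : 1 ≤ j) : Continuous (deriv Γ) :=
  (hΓ.contDiff_deriv hj).continuous

lemma apply_ne_apply_add (hΓ : IsOval M j l Γ) (s : ℝ) {d : ℝ} (hd : d ∈ Ioo 0 l) :
    Γ s ≠ Γ (s + d) := by
  have hl : 0 < l := hd.1.trans hd.2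
  have : Fact (0 < l) := ⟨hl⟩
  rw [Ne, hΓ.apply_eq_iff hl, AddCircle.coe_add, left_eq_add, AddCircle.coe_eq_zero_iff_of_mem_Ico
    ⟨hd.1.le, hd.2⟩]
  exact hd.1.ne'

/-- The point `t` can be moved to the period that starts at `s`. -/
lemma exists_add_of_ne (hΓ : IsOval M j l Γ) (hl : 0 < l) {s t : ℝ} (h : Γ s ≠ Γ t) :
    ∃ d ∈ Ioo 0 l, ((s + d : ℝ) : AddCircle l) = t := by
  have hm := toIcoMod_mem_Ico hl s t
  have c : ((toIcoMod hl s t : ℝ) : AddCircle l) = t := by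
    rw [toIcoMod, AddCircle.coe_sub, AddCircle.coe_zsmul, AddCircle.coe_period]; simp
  refine ⟨toIcoMod hl s t - s, ⟨?_, by linarith [hm.2]⟩, by rw [add_sub_cancel, c]⟩
  refine sub_pos.2 (lt_of_le_of_ne hm.1 fun e => h ?_)
  rw [hΓ.apply_eq_iff hl, ← c, ← e]

/-- The height of `Γ (s + d)` over the tangent at `Γ s` is continuous and nowhere zero on the
connected set `ℝ × (0, l)`. Its sign depends on the orientation of `Γ`, hence the formulation by
products. -/
lemma height_mul_height_pos (hΓ : IsOval M j l Γ) (hl : 0 < l) (hj : 1 ≤ j) {s t s' t' : ℝ}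
    (h : Γ s ≠ Γ t) (h' : Γ s' ≠ Γ t') : 0 < height Γ s t * height Γ s' t' := by
  have hc : Continuous fun x : ℝ × ℝ => height Γ x.1 (x.1 + x.2) := by
    have h1 := hΓ.continuous
    have h2 := hΓ.continuous_deriv hj
    unfold height triple
    fun_prop
  have hpre : IsPreconnected ((univ : Set ℝ) ×ˢ Ioo 0 l) :=
    isPreconnected_univ.prod isPreconnected_Ioo
  have hne : ∀ x ∈ (univ : Set ℝ) ×ˢ Ioo 0 l, height Γ x.1 (x.1 + x.2) ≠ 0 := fun x hx =>
    hΓ.height_ne_zero hj (hΓ.apply_ne_apply_add _ hx.2)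
  obtain ⟨d, hd, e⟩ := hΓ.exists_add_of_ne hl h
  obtain ⟨d', hd', e'⟩ := hΓ.exists_add_of_ne hl h'
  have e1 : height Γ s t = height Γ s (s + d) := by rw [height, height, (hΓ.apply_eq_iff hl).2 e]
  have e2 : height Γ s' t' = height Γ s' (s' + d') := by
    rw [height, height, (hΓ.apply_eq_iff hl).2 e']
  have hor := hpre.image _ hc.continuousOn
  have hoc := hor.ordConnected
  rw [e1, e2]
  by_contra! hle
  have m1 := mem_image_of_mem (fun x : ℝ × ℝ => height Γ x.1 (x.1 + x.2))
    (show (s, d) ∈ (univ : Set ℝ) ×ˢ Ioo 0 l from ⟨mem_univ _, hd⟩)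
  have m2 := mem_image_of_mem (fun x : ℝ × ℝ => height Γ x.1 (x.1 + x.2))
    (show (s', d') ∈ (univ : Set ℝ) ×ˢ Ioo 0 l from ⟨mem_univ _, hd'⟩)
  have : (0 : ℝ) ∈ (fun x : ℝ × ℝ => height Γ x.1 (x.1 + x.2)) '' ((univ : Set ℝ) ×ˢ Ioo 0 l) := by
    rcases mul_nonpos_iff.1 hle with ⟨ha, hb⟩ | ⟨ha, hb⟩
    · exact hoc.out m2 m1 ⟨hb, ha⟩
    · exact hoc.out m1 m2 ⟨ha, hb⟩
  obtain ⟨x, hx, hx0⟩ := this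
  exact hne x hx hx0

end IsOval

/-- The cosine of the angle at `Γ s` between the velocity of `Γ` and the chord to `Γ t`. -/
noncomputable def angleCos (M : Model) (Γ : ℝ → V) (s t : ℝ) : ℝ :=
  chordCos M (Γ s) (deriv Γ s) (Γ t)

/-- The mixed second derivative of the length of the chord from `Γ s` to `Γ t`. -/
noncomputable def chordDensity (M : Model) (Γ : ℝ → V) (s t : ℝ) : ℝ :=
  height Γ s t * height Γ t s / √(towardSq M (Γ s) (Γ t)) ^ 3

/-! ### The angle of a chord as a function of its far endpoint -/

namespace IsOval

lemma abs_angleCos_lt_one (hΓ : IsOval M j l Γ) (hj : 1 ≤ j) (s t : ℝ) :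
    |angleCos M Γ s t| < 1 :=
  abs_chordCos_lt_one (hΓ.mem_surface s) (hΓ.mem_surface t) (hΓ.levelForm_deriv hj s)
    (hΓ.unit_speed s) (hΓ.height_ne_zero hj)

lemma chordDensity_pos (hΓ : IsOval M j l Γ) (hl : 0 < l) (hj : 1 ≤ j) {s t : ℝ}
    (h : Γ s ≠ Γ t) : 0 < chordDensity M Γ s t :=
  div_pos (hΓ.height_mul_height_pos hl hj h h.symm)
    (pow_pos (Real.sqrt_pos.2 (towardSq_pos (hΓ.mem_surface s) (hΓ.mem_surface t) h)) 3)

lemma chordDensity_comm (hΓ : IsOval M j l Γ) (s t : ℝ) :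
    chordDensity M Γ s t = chordDensity M Γ t s := by
  rw [chordDensity, chordDensity, mul_comm, towardSq_comm (hΓ.mem_surface s) (hΓ.mem_surface t)]

/-- With `N = toward M (Γ s) (Γ t)`, the numerator in the derivative of `⟨N, e⟩ / |N|` is the Gram
determinant `⟨N, N⟩⟨N', e⟩ - ⟨N, e⟩⟨N', N⟩`. It factors into two area forms, which are the heights
seen from the two ends, up to sign. -/
lemma hasDerivAt_angleCos (hΓ : IsOval M j l Γ) (hj : 1 ≤ j) {s t : ℝ} (h : Γ s ≠ Γ t) :
    HasDerivAt (angleCos M Γ s) (-chordDensity M Γ s t) t := by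
  have hp := hΓ.mem_surface s
  have hR := towardSq_pos hp (hΓ.mem_surface t) h
  have hN := hasDerivAt_toward M (Γ s) (hΓ.hasDerivAt hj t)
  have h1 := hasDerivAt_form M hN (hasDerivAt_const t (deriv Γ s))
  have h2 := hasDerivAt_form M hN hN
  have h0 : form M (toward M (Γ s) (Γ t)) 0 = 0 := by
    rw [← zero_smul ℝ (Γ s), form_smul_right, zero_mul]
  have h3 := h1.div (h2.sqrt hR.ne') (Real.sqrt_pos.2 hR).ne'
  refine h3.congr_deriv ?_
  have g := gram_eq_triple_mul_triple hp (levelForm_toward hp (Γ t))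
    (levelForm_toward hp (deriv Γ t)) (levelForm_toward hp (Γ t)) (hΓ.levelForm_deriv hj s)
  have hs := Real.sqrt_pos.2 hR
  have hsq := Real.sq_sqrt hR.le
  rw [triple_toward_toward, triple_toward_left, triple_swap (Γ s) (deriv Γ s) (Γ t),
    ← triple_rotate (Γ s) (Γ t), ← towardSq, ← hsq] at g
  rw [h0, form_comm M (toward M (Γ s) (Γ t)) (toward M (Γ s) (deriv Γ t)), ← towardSq,
    chordDensity, height, height]
  field_simp
  linear_combination 2 * g

lemma height_self (Γ : ℝ → V) (s : ℝ) : height Γ s s = 0 := by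
  simp only [height, triple]; ring

lemma chordDensity_eq_zero {Γ : ℝ → V} {s t : ℝ} (h : Γ s = Γ t) : chordDensity M Γ s t = 0 := by
  have : height Γ s t = 0 := by rw [height, ← h]; exact height_self Γ s
  rw [chordDensity, this, zero_mul, zero_div]

lemma periodic_chordDensity (hΓ : IsOval M j l Γ) (s : ℝ) :
    Function.Periodic (chordDensity M Γ s) l := fun t => by
  simp only [chordDensity, height, hΓ.closed t, hΓ.periodic_deriv t]

lemma angleCos_congr (hΓ : IsOval M j l Γ) {s s' t t' : ℝ} (hs : (s : AddCircle l) = s')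
    (ht : (t : AddCircle l) = t') : angleCos M Γ s t = angleCos M Γ s' t' := by
  have h : ∀ {f : ℝ → V}, Function.Periodic f l → ∀ {a b : ℝ}, (a : AddCircle l) = b → f a = f b :=
    fun hf a b hab => by simpa using congrArg hf.lift hab
  rw [angleCos, angleCos, h hΓ.closed hs, h hΓ.closed ht, h hΓ.periodic_deriv hs]

/-- The difference quotient of `toward` tends to the unit velocity. Cancelling `(t - s)⁻¹` against
its absolute value under the root gives the limits 1 and -1 of `angleCos` on the two sides. -/
lemma tendsto_chordCos (hΓ : IsOval M j l Γ) (hj : 1 ≤ j) (s : ℝ) :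
    Tendsto (fun t => form M ((t - s)⁻¹ • toward M (Γ s) (Γ t)) (deriv Γ s) /
      √(form M ((t - s)⁻¹ • toward M (Γ s) (Γ t)) ((t - s)⁻¹ • toward M (Γ s) (Γ t))))
      (𝓝[≠] s) (𝓝 1) := by
  have hp := hΓ.mem_surface s
  have h := hasDerivAt_iff_tendsto_slope.1 (hasDerivAt_toward M (Γ s) (hΓ.hasDerivAt hj s))
  have e : toward M (Γ s) (deriv Γ s) = deriv Γ s := by
    rw [toward, hΓ.levelForm_deriv hj, zero_smul, sub_zero]
  rw [e] at h
  have hc : ContinuousAt (fun v : V => form M v (deriv Γ s) / √(form M v v)) (deriv Γ s) := by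
    have h1 : Continuous fun v : V => form M v (deriv Γ s) := by
      cases M <;> simp only [form] <;> fun_prop
    have h2 : Continuous fun v : V => form M v v := by
      cases M <;> simp only [form] <;> fun_prop
    exact h1.continuousAt.div h2.sqrt.continuousAt (by simp [hΓ.unit_speed s])
  have := hc.tendsto.comp h
  simp only [hΓ.unit_speed s, Real.sqrt_one, div_one] at this
  refine this.congr fun t => ?_
  simp only [Function.comp, slope, vsub_eq_sub, toward_self hp, sub_zero]

lemma tendsto_angleCos_right (hΓ : IsOval M j l Γ) (hj : 1 ≤ j) (s : ℝ) :
    Tendsto (angleCos M Γ s) (𝓝[>] s) (𝓝 1) := by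
  refine ((hΓ.tendsto_chordCos hj s).mono_left
    (nhdsWithin_mono s fun t ht => ne_of_gt ht)).congr' ?_
  filter_upwards [self_mem_nhdsWithin] with t ht
  have ht : 0 < (t - s)⁻¹ := inv_pos.2 (sub_pos.2 ht)
  rw [form_smul_left, form_smul_left, form_smul_right, ← mul_assoc, ← towardSq, ← pow_two,
    Real.sqrt_mul (by positivity), Real.sqrt_sq ht.le, mul_div_mul_left _ _ ht.ne']
  rfl

lemma tendsto_angleCos_left (hΓ : IsOval M j l Γ) (hj : 1 ≤ j) (s : ℝ) :
    Tendsto (angleCos M Γ s) (𝓝[<] s) (𝓝 (-1)) := by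
  refine (((hΓ.tendsto_chordCos hj s).mono_left
    (nhdsWithin_mono s fun t ht => ne_of_lt ht)).neg).congr' ?_
  filter_upwards [self_mem_nhdsWithin] with t ht
  have ht : 0 < -(t - s)⁻¹ := neg_pos.2 (inv_lt_zero.2 (sub_neg.2 ht))
  rw [form_smul_left, form_smul_left, form_smul_right, ← mul_assoc, ← towardSq, ← pow_two,
    ← neg_sq, Real.sqrt_mul (by positivity), Real.sqrt_sq ht.le, ← neg_div, ← neg_mul,
    mul_div_mul_left _ _ ht.ne']
  rfl

lemma apply_ne_of_mem_Ioo (hΓ : IsOval M j l Γ) {s t : ℝ} (ht : t ∈ Ioo s (s + l)) :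
    Γ s ≠ Γ t := by
  have := hΓ.apply_ne_apply_add s (d := t - s) ⟨sub_pos.2 ht.1, by linarith [ht.2]⟩
  rwa [add_sub_cancel] at this

lemma strictAntiOn_angleCos (hΓ : IsOval M j l Γ) (hl : 0 < l) (hj : 1 ≤ j) (s : ℝ) :
    StrictAntiOn (angleCos M Γ s) (Ioo s (s + l)) := by
  refine strictAntiOn_of_deriv_neg (convex_Ioo _ _) (fun t ht =>
    (hΓ.hasDerivAt_angleCos hj (hΓ.apply_ne_of_mem_Ioo ht)).continuousAt.continuousWithinAt)
    fun t ht => ?_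
  rw [interior_Ioo] at ht
  rw [(hΓ.hasDerivAt_angleCos hj (hΓ.apply_ne_of_mem_Ioo ht)).deriv]
  exact neg_neg_of_pos (hΓ.chordDensity_pos hl hj (hΓ.apply_ne_of_mem_Ioo ht))

lemma image_angleCos (hΓ : IsOval M j l Γ) (hl : 0 < l) (hj : 1 ≤ j) (s : ℝ) :
    angleCos M Γ s '' Ioo s (s + l) = Ioo (-1) 1 := by
  have hlt : s < s + l := by linarith
  apply Subset.antisymm
  · rintro _ ⟨t, -, rfl⟩
    exact abs_lt.1 (hΓ.abs_angleCos_lt_one hj s t)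
  · have hcont : ContinuousOn (angleCos M Γ s) (Ioo s (s + l)) := fun t ht =>
      (hΓ.hasDerivAt_angleCos hj (hΓ.apply_ne_of_mem_Ioo ht)).continuousAt.continuousWithinAt
    -- By periodicity, the far end of the period is the left-hand limit at the base point itself.
    have h1 : Tendsto (angleCos M Γ s) (𝓝[<] (s + l)) (𝓝 (-1)) := by
      have := hΓ.tendsto_angleCos_left hj (s + l)
      refine this.congr fun t => hΓ.angleCos_congr ?_ rfl
      rw [AddCircle.coe_add, AddCircle.coe_period, add_zero]
    have := left_nhdsWithin_Ioo_neBot hlt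
    have := right_nhdsWithin_Ioo_neBot hlt
    exact isPreconnected_Ioo.intermediate_value_Ioo (l₁ := 𝓝[Ioo s (s + l)] (s + l))
      (l₂ := 𝓝[Ioo s (s + l)] s) inf_le_right inf_le_right hcont
      (h1.mono_left (nhdsWithin_mono _ Ioo_subset_Iio_self))
      ((hΓ.tendsto_angleCos_right hj s).mono_left (nhdsWithin_mono _ Ioo_subset_Ioi_self))

/-- Every direction at `Γ s` is the direction of a chord. -/
lemma exists_chord (hΓ : IsOval M j l Γ) (hl : 0 < l) (hj : 1 ≤ j) (s : ℝ) {y : ℝ}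
    (hy : y ∈ Ioo (-1 : ℝ) 1) : ∃ t, Γ s ≠ Γ t ∧ angleCos M Γ s t = y := by
  rw [← hΓ.image_angleCos hl hj s] at hy
  obtain ⟨t, ht, e⟩ := hy
  exact ⟨t, hΓ.apply_ne_of_mem_Ioo ht, e⟩

lemma coe_eq_coe_of_angleCos_eq (hΓ : IsOval M j l Γ) (hl : 0 < l) (hj : 1 ≤ j) {s t t' : ℝ}
    (h : Γ s ≠ Γ t) (h' : Γ s ≠ Γ t') (e : angleCos M Γ s t = angleCos M Γ s t') :
    (t : AddCircle l) = t' := by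
  obtain ⟨d, hd, c⟩ := hΓ.exists_add_of_ne hl h
  obtain ⟨d', hd', c'⟩ := hΓ.exists_add_of_ne hl h'
  rw [hΓ.angleCos_congr rfl c.symm, hΓ.angleCos_congr (t := t') rfl c'.symm] at e
  have := (hΓ.strictAntiOn_angleCos hl hj s).injOn ⟨by linarith [hd.1], by linarith [hd.2]⟩
    ⟨by linarith [hd'.1], by linarith [hd'.2]⟩ e
  rw [← c, ← c', this]

end IsOval
end
/-! ### The region bounded by an oval -/

/-- The open cone over the open chords of `Γ`. -/
def chordCone (Γ : ℝ → V) : Set V :=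
  {x | ∃ s t a b : ℝ, Γ s ≠ Γ t ∧ 0 < a ∧ 0 < b ∧ x = a • Γ s + b • Γ t}

/-- The radial projection to the surface. -/
noncomputable def normalize (M : Model) (y : V) : V := (√(levelForm M y y))⁻¹ • y

/-- The union of the closed chords of `Γ`. -/
noncomputable def chordHull (M : Model) (l : ℝ) (Γ : ℝ → V) : Set V :=
  (fun x : ℝ × ℝ × ℝ => normalize M ((1 - x.2.2) • Γ x.1 + x.2.2 • Γ x.2.1)) ''
    (Icc 0 l ×ˢ Icc 0 l ×ˢ Icc 0 1)

lemma levelForm_comb_pos {M : Model} {p q : V} {a b : ℝ} (hp : p ∈ surface M)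
    (hq : q ∈ surface M) (ha : 0 ≤ a) (hb : 0 ≤ b) (hab : 0 < a + b) :
    0 < levelForm M (a • p + b • q) (a • p + b • q) := by
  obtain ⟨hp1, hp2⟩ := mem_surface_iff.1 hp
  obtain ⟨hq1, hq2⟩ := mem_surface_iff.1 hq
  have h2 : 0 < (a • p + b • q) 2 := by
    simp only [Pi.add_apply, Pi.smul_apply, smul_eq_mul]
    rcases ha.eq_or_lt with rfl | ha
    · have : 0 < b := by linarith
      positivity
    · positivity
  cases M
  · exact mul_pos h2 h2
  · simp only [levelForm]
    nlinarith [mul_pos h2 h2, mul_self_nonneg ((a • p + b • q) 0),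
      mul_self_nonneg ((a • p + b • q) 1)]
  · have hc := levelForm_hyperbolic_pos hp hq
    have e : levelForm .hyperbolic (a • p + b • q) (a • p + b • q) =
        a ^ 2 * levelForm .hyperbolic p p + 2 * (a * b) * levelForm .hyperbolic p q +
          b ^ 2 * levelForm .hyperbolic q q := by
      simp only [levelForm, Pi.add_apply, Pi.smul_apply, smul_eq_mul]; ring
    rw [e, hp1, hq1]
    have : 0 ≤ a * b := mul_nonneg ha hb
    nlinarith [mul_nonneg this hc.le, sq_nonneg (a - b)]

lemma normalize_mem {M : Model} {y : V} (hy : 0 < levelForm M y y) (h2 : 0 < y 2) :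
    normalize M y ∈ surface M := by
  have hs := Real.sqrt_pos.2 hy
  refine mem_surface_iff.2 ⟨?_, ?_⟩
  · rw [normalize, levelForm_smul_left, levelForm_smul_right]
    nth_rw 3 [← Real.mul_self_sqrt hy.le]
    field_simp
  · simp only [normalize, Pi.smul_apply, smul_eq_mul]
    positivity

lemma normalize_smul_of_mem {M : Model} {x : V} {c : ℝ} (hx : x ∈ surface M) (hc : 0 < c) :
    normalize M (c • x) = x := by
  rw [normalize, levelForm_smul_left, levelForm_smul_right, (mem_surface_iff.1 hx).1, mul_one,
    Real.sqrt_mul_self hc.le, inv_smul_smul₀ hc.ne']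

lemma smul_eq_of_mem_surface {M : Model} {p : V} {c : ℝ} (hp : p ∈ surface M)
    (h : c • p ∈ surface M) : c • p = p := by
  have h2 := (mem_surface_iff.1 h).2
  have hc : 0 < c := pos_of_mul_pos_left h2 (mem_surface_iff.1 hp).2.le
  rw [← normalize_smul_of_mem h one_pos, one_smul, normalize_smul_of_mem hp hc]

lemma triple_comb (x y p q : V) (a b : ℝ) :
    triple x y (a • p + b • q) = a * triple x y p + b * triple x y q := by
  simp only [triple, Pi.add_apply, Pi.smul_apply, smul_eq_mul]; ring

/-- Cramer's rule, with the summands in the order in which the differential of `(a, b, t) ↦ a • Γ s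
+ b • Γ t` produces them. -/
lemma cramer {p q r : V} (h : triple p q r ≠ 0) (y : V) :
    (triple y q r / triple p q r) • p + ((triple p q y / triple p q r) • r +
      (triple p y r / triple p q r) • q) = y := by
  have e : ∀ i, triple y q r * p i + (triple p q y * r i + triple p y r * q i) =
      triple p q r * y i := by
    intro i
    fin_cases i <;> simp only [triple] <;> simp <;> ring
  ext i
  simp only [Pi.add_apply, Pi.smul_apply, smul_eq_mul]
  field_simp
  linear_combination e i

section
variable {M : Model} {j : ℕ∞} {l : ℝ} {Γ : ℝ → V}

namespace IsOval

/-- Measured over the tangent at `Γ r`, both endpoints of a chord have heights of one sign, not both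
zero, so a positive combination of them cannot have the height zero of `Γ r`. -/
lemma disjoint_chordCone (hΓ : IsOval M j l Γ) (hl : 0 < l) (hj : 1 ≤ j) :
    Disjoint (chordCone Γ) (range Γ) := by
  rw [Set.disjoint_left]
  rintro _ ⟨s, t, a, b, hst, ha, hb, rfl⟩ ⟨r, hr⟩
  have h0 : a * height Γ r s + b * height Γ r t = 0 := by
    rw [height, height, ← triple_comb, ← hr]; exact height_self Γ r
  by_cases hs : Γ r = Γ s
  · have h1 : height Γ r s = 0 := by
      rw [height, ← hs]; exact height_self Γ r
    rw [h1, mul_zero, zero_add] at h0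
    exact hΓ.height_ne_zero hj (hs ▸ hst) ((mul_eq_zero.1 h0).resolve_left hb.ne')
  by_cases ht : Γ r = Γ t
  · have h1 : height Γ r t = 0 := by
      rw [height, ← ht]; exact height_self Γ r
    rw [h1, mul_zero, add_zero] at h0
    exact hΓ.height_ne_zero hj hs ((mul_eq_zero.1 h0).resolve_left ha.ne')
  have h1 := hΓ.height_mul_height_pos hl hj hs ht
  have h2 : 0 < height Γ r s ^ 2 := by have := hΓ.height_ne_zero hj hs; positivity
  have : a * height Γ r s ^ 2 + b * (height Γ r s * height Γ r t) = 0 := by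
    linear_combination height Γ r s * h0
  nlinarith [mul_pos ha h2, mul_pos hb h1]

/-- Keep `s` fixed and vary `(a, b, t)`: the Jacobian is `b * height Γ t s`, which is nonzero, so
the map is locally onto. Working with a cone makes this a statement about open sets of `ℝ³`. -/
lemma isOpen_chordCone (hΓ : IsOval M j l Γ) (hj : 1 ≤ j) : IsOpen (chordCone Γ) := by
  rw [isOpen_iff_mem_nhds]
  rintro _ ⟨s, t, a, b, hst, ha, hb, rfl⟩
  have hd : HasStrictDerivAt Γ (deriv Γ t) t :=
    hΓ.contDiff.contDiffAt.hasStrictDerivAt (by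
      intro h
      have : j = 0 := by exact_mod_cast h
      simp [this] at hj)
  have h1 : HasStrictFDerivAt (fun x : ℝ × ℝ × ℝ => x.1 • Γ s) _ (a, b, t) :=
    (hasStrictFDerivAt_fst (𝕜 := ℝ)).smul_const (Γ s)
  have h2 : HasStrictFDerivAt (fun x : ℝ × ℝ × ℝ => Γ x.2.2) _ (a, b, t) :=
    hd.hasStrictFDerivAt.comp (a, b, t)
      ((hasStrictFDerivAt_snd (𝕜 := ℝ)).comp (a, b, t) (hasStrictFDerivAt_snd (𝕜 := ℝ)))
  have h3 : HasStrictFDerivAt (fun x : ℝ × ℝ × ℝ => x.2.1) _ (a, b, t) :=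
    (hasStrictFDerivAt_fst (𝕜 := ℝ)).comp (a, b, t) (hasStrictFDerivAt_snd (𝕜 := ℝ))
  have h4 := h1.add (h3.smul h2)
  have hD : triple (Γ s) (Γ t) (deriv Γ t) ≠ 0 := by
    rw [← triple_rotate]; exact hΓ.height_ne_zero hj hst.symm
  have hmap := h4.map_nhds_eq_of_surj (by
    rw [LinearMap.range_eq_top]
    intro y
    refine ⟨(triple y (Γ t) (deriv Γ t) / triple (Γ s) (Γ t) (deriv Γ t),
      triple (Γ s) y (deriv Γ t) / triple (Γ s) (Γ t) (deriv Γ t),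
      triple (Γ s) (Γ t) y / triple (Γ s) (Γ t) (deriv Γ t) / b), ?_⟩
    simp only [ContinuousLinearMap.toLinearMap_add, ContinuousLinearMap.coe_smulRight,
      ContinuousLinearMap.coe_fst, ContinuousLinearMap.toLinearMap_smul,
      ContinuousLinearMap.toLinearMap_comp, ContinuousLinearMap.toLinearMap_toSpanSingleton,
      ContinuousLinearMap.coe_snd, LinearMap.add_apply, LinearMap.coe_smulRight,
      LinearMap.fst_apply, LinearMap.smul_apply, LinearMap.coe_comp, LinearMap.coe_snd,
      Function.comp_apply, LinearMap.toSpanSingleton_apply, LinearMap.coe_fst]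
    rw [smul_smul, mul_div_cancel₀ _ hb.ne']
    exact cramer hD y)
  change map _ _ = 𝓝 (a • Γ s + b • Γ t) at hmap
  rw [← hmap, mem_map]
  have hc : ContinuousAt (fun x : ℝ × ℝ × ℝ => Γ x.2.2) (a, b, t) := h2.continuousAt
  have ea : ∀ᶠ x : ℝ × ℝ × ℝ in 𝓝 (a, b, t), 0 < x.1 :=
    continuousAt_fst.eventually (lt_mem_nhds ha)
  have eb : ∀ᶠ x : ℝ × ℝ × ℝ in 𝓝 (a, b, t), 0 < x.2.1 :=
    h3.continuousAt.eventually (lt_mem_nhds hb)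
  filter_upwards [ea, eb, hc.eventually_ne hst.symm] with x hxa hxb hx
  exact ⟨s, x.2.2, x.1, x.2.1, hx.symm, hxa, hxb, rfl⟩

lemma comb_apply_two_pos (hΓ : IsOval M j l Γ) {s t a b : ℝ} (ha : 0 ≤ a) (hb : 0 ≤ b)
    (hab : 0 < a + b) : 0 < (a • Γ s + b • Γ t) 2 := by
  have hp2 := (mem_surface_iff.1 (hΓ.mem_surface s)).2
  have hq2 := (mem_surface_iff.1 (hΓ.mem_surface t)).2
  simp only [Pi.add_apply, Pi.smul_apply, smul_eq_mul]
  rcases ha.eq_or_lt with rfl | ha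
  · have : 0 < b := by linarith
    positivity
  · positivity

lemma chordHull_subset (hΓ : IsOval M j l Γ) : chordHull M l Γ ⊆ surface M := by
  rintro _ ⟨⟨s, t, r⟩, ⟨-, -, h0, h1⟩, rfl⟩
  have h0' : 0 ≤ 1 - r := sub_nonneg.2 h1
  have h1' : 0 < (1 - r) + r := by linarith
  exact normalize_mem (levelForm_comb_pos (hΓ.mem_surface s) (hΓ.mem_surface t) h0' h0 h1')
    (hΓ.comb_apply_two_pos h0' h0 h1')

lemma isCompact_chordHull (hΓ : IsOval M j l Γ) : IsCompact (chordHull M l Γ) := by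
  refine (isCompact_Icc.prod (isCompact_Icc.prod isCompact_Icc)).image_of_continuousOn ?_
  have hc := hΓ.continuous
  have hy : Continuous fun x : ℝ × ℝ × ℝ => (1 - x.2.2) • Γ x.1 + x.2.2 • Γ x.2.1 := by fun_prop
  have hL : Continuous fun y : V => levelForm M y y := by
    cases M <;> simp only [levelForm] <;> fun_prop
  refine ContinuousOn.smul (ContinuousOn.inv₀ (hL.comp hy).sqrt.continuousOn ?_) hy.continuousOn
  rintro ⟨s, t, r⟩ ⟨-, -, h0, h1⟩
  exact (Real.sqrt_pos.2 (levelForm_comb_pos (hΓ.mem_surface s) (hΓ.mem_surface t)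
    (sub_nonneg.2 h1) h0 (by linarith))).ne'

lemma chordCone_inter_subset (hΓ : IsOval M j l Γ) (hl : 0 < l) :
    chordCone Γ ∩ surface M ⊆ chordHull M l Γ := by
  rintro _ ⟨⟨s, t, a, b, hst, ha, hb, rfl⟩, hx⟩
  obtain ⟨s', hs', es⟩ := hΓ.closed.exists_mem_Ico₀ hl s
  obtain ⟨t', ht', et⟩ := hΓ.closed.exists_mem_Ico₀ hl t
  have hab : 0 < a + b := by linarith
  refine ⟨(s', t', b / (a + b)), ⟨Ico_subset_Icc_self hs', Ico_subset_Icc_self ht', ?_, ?_⟩, ?_⟩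
  · positivity
  · rw [div_le_one hab]; linarith
  · have e : (1 - b / (a + b)) • Γ s + (b / (a + b)) • Γ t =
        (a + b)⁻¹ • (a • Γ s + b • Γ t) := by
      ext i
      simp only [Pi.add_apply, Pi.smul_apply, smul_eq_mul]
      field_simp
      ring
    simp only [← es, ← et, e]
    exact normalize_smul_of_mem hx (inv_pos.2 hab)

lemma chordHull_diff_subset (hΓ : IsOval M j l Γ) :
    chordHull M l Γ \ range Γ ⊆ chordCone Γ := by
  rintro x ⟨hx, hxΓ⟩
  have hxS := hΓ.chordHull_subset hx
  obtain ⟨⟨s, t, r⟩, ⟨-, -, h0, h1⟩, rfl⟩ := hx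
  dsimp only at *
  have h0' : 0 ≤ 1 - r := sub_nonneg.2 h1
  have hpos := Real.sqrt_pos.2 (levelForm_comb_pos (hΓ.mem_surface s) (hΓ.mem_surface t) h0' h0
    (by linarith))
  -- A ray meets the surface at most once, so a multiple of `Γ q` on the surface is `Γ q`. This
  -- excludes equal endpoints and the parameters `r = 0` and `r = 1`.
  have key : ∀ (c q : ℝ), normalize M ((1 - r) • Γ s + r • Γ t) ≠ c • Γ q := fun c q e =>
    hxΓ ⟨q, by rw [e] at hxS ⊢; exact (smul_eq_of_mem_surface (hΓ.mem_surface q) hxS).symm⟩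
  rw [normalize] at key ⊢
  set k := √(levelForm M ((1 - r) • Γ s + r • Γ t) ((1 - r) • Γ s + r • Γ t))
  refine ⟨s, t, k⁻¹ * (1 - r), k⁻¹ * r, fun e => key k⁻¹ t ?_, ?_, ?_, ?_⟩
  · rw [e, ← add_smul, sub_add_cancel, one_smul]
  · refine mul_pos (inv_pos.2 hpos) (h0'.lt_of_ne fun e => key (k⁻¹ * r) t ?_)
    rw [← e, zero_smul, zero_add, smul_smul]
  · refine mul_pos (inv_pos.2 hpos) (h0.lt_of_ne fun e => key (k⁻¹ * (1 - r)) s ?_)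
    rw [← e, zero_smul, add_zero, smul_smul]
  · rw [smul_add, smul_smul, smul_smul]

/-- Inside `S \ Γ`, the open cone and the compact hull have the same trace, which is therefore open
and closed. A connected component that meets it stays in the compact hull. -/
lemma chordCone_inter_subset_region (hΓ : IsOval M j l Γ) (hl : 0 < l) (hj : 1 ≤ j) :
    chordCone Γ ∩ surface M ⊆ region M Γ := by
  rintro x ⟨hx, hxS⟩
  have hmem : x ∈ surface M \ range Γ :=
    ⟨hxS, fun h => Set.disjoint_left.1 (hΓ.disjoint_chordCone hl hj) hx h⟩
  refine ⟨hmem, chordHull M l Γ, hΓ.chordHull_subset, hΓ.isCompact_chordHull, ?_⟩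
  set C := connectedComponentIn (surface M \ range Γ) x
  have hsub : C ⊆ surface M \ range Γ := connectedComponentIn_subset _ _
  have hpre : IsPreconnected C := isPreconnected_connectedComponentIn
  have hxC : x ∈ C := mem_connectedComponentIn hmem
  have hxK := hΓ.chordCone_inter_subset hl ⟨hx, hxS⟩
  rcases isPreconnected_iff_subset_of_disjoint.1 hpre (chordCone Γ) (chordHull M l Γ)ᶜ
    (hΓ.isOpen_chordCone hj) hΓ.isCompact_chordHull.isClosed.isOpen_compl
    (fun z hz => or_iff_not_imp_right.2 fun h =>
      hΓ.chordHull_diff_subset ⟨not_not.1 h, (hsub hz).2⟩)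
    (eq_empty_of_forall_notMem fun z ⟨hz, hz1, hz2⟩ =>
      hz2 (hΓ.chordCone_inter_subset hl ⟨hz1, (hsub hz).1⟩)) with h | h
  · exact fun z hz => hΓ.chordCone_inter_subset hl ⟨h hz, (hsub hz).1⟩
  · exact absurd hxK (h hxC)

/-! ### The billiard step -/

/-- Reflection keeps the tangential component, and the arriving velocity is minus the direction back
to `Γ s`; hence the sign in the last condition. From a step to a chord, only the membership of the
path in `S` is used; the converse needs open chords to lie in `Ω`. -/
lemma step_iff (hΓ : IsOval M j l Γ) (hl : 0 < l) (hj : 1 ≤ j) (c c' : Cyl l) :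
    Step M l Γ c c' ↔ ∃ s t : ℝ, (s : AddCircle l) = c.1 ∧ (t : AddCircle l) = c'.1 ∧ Γ s ≠ Γ t ∧
      angleCos M Γ s t = Real.cos c.2 ∧ -angleCos M Γ t s = Real.cos c'.2 := by
  have hrefl : ∀ (s : ℝ) (v : V), form M (reflect M (deriv Γ s) v) (deriv Γ s) =
      form M v (deriv Γ s) := fun s v => by
    rw [reflect, form_sub_left, form_smul_left, hΓ.unit_speed]; ring
  constructor
  · rintro ⟨s, t, hs, ht, τ, hτ, hτ1, hψ, r, hr, hreg, hend, hψ'⟩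
    have hp := hΓ.mem_surface s
    have hτ' := (mem_tangentPlane_iff hp).1 hτ
    have hq : geodesic M (Γ s) τ r ∈ surface M := hend ▸ hΓ.mem_surface t
    obtain ⟨h1, h2, h3⟩ := geodesic_data hp hτ' hτ1
      (geoSin_pos_of_mem_surface hp hr (fun u hu => (hreg u hu).1.1) hq) hq
    rw [hrefl, h3, form_neg_left] at hψ'
    rw [hend] at h1 h2 hψ'
    refine ⟨s, t, hs, ht, h1, ?_, ?_⟩
    · rw [angleCos, chordCos_eq, ← h2, hψ]
    · rw [angleCos, chordCos_eq, hψ']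
  · rintro ⟨s, t, hs, ht, hst, hψ, hψ'⟩
    have hp := hΓ.mem_surface s
    have hq := hΓ.mem_surface t
    obtain ⟨r, hr, hend, hd, hu⟩ := exists_geodesic hp hq hst
    refine ⟨s, t, hs, ht, direction M (Γ s) (Γ t), (mem_tangentPlane_iff hp).2
      (levelForm_direction hp _), form_direction hp hq hst, ?_, r, hr, fun u hu' => ?_, hend, ?_⟩
    · rw [← chordCos_eq]; exact hψ
    · obtain ⟨h1, a, b, ha, hb, e⟩ := hu u hu'
      exact hΓ.chordCone_inter_subset_region hl hj ⟨⟨s, t, a, b, hst, ha, hb, e⟩, h1⟩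
    · rw [hrefl, hd, form_neg_left, ← chordCos_eq]; exact hψ'

end IsOval
end
lemma cos_mem_Ioo {ψ : ℝ} (hψ : ψ ∈ Ioo 0 Real.pi) : Real.cos ψ ∈ Ioo (-1 : ℝ) 1 := by
  constructor
  · rw [← Real.cos_pi]
    exact Real.cos_lt_cos_of_nonneg_of_le_pi hψ.1.le le_rfl hψ.2
  · rw [← Real.cos_zero]
    exact Real.cos_lt_cos_of_nonneg_of_le_pi le_rfl hψ.2.le hψ.1

lemma flip_flip {l : ℝ} (c : Cyl l) : flip (flip c) = c :=
  Prod.ext rfl (Subtype.ext (sub_sub_cancel _ _))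

section
variable {M : Model} {j : ℕ∞} {l : ℝ} {Γ : ℝ → V}

/-! ### Chords as phase points, and the billiard map as exchange of endpoints -/

namespace IsOval

/-- The position and direction on the cylinder of the chord from `Γ s` to `Γ t`. -/
noncomputable def chordPhase (hΓ : IsOval M j l Γ) (hj : 1 ≤ j) (s t : ℝ) : Cyl l :=
  (s, ⟨Real.arccos (angleCos M Γ s t),
    Real.arccos_pos.2 (abs_lt.1 (hΓ.abs_angleCos_lt_one hj s t)).2,
    (Real.arccos_le_pi _).lt_of_ne fun h =>
      (abs_lt.1 (hΓ.abs_angleCos_lt_one hj s t)).1.not_ge (Real.arccos_eq_pi.1 h)⟩)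

lemma cos_arccos_angleCos (hΓ : IsOval M j l Γ) (hj : 1 ≤ j) (s t : ℝ) :
    Real.cos (Real.arccos (angleCos M Γ s t)) = angleCos M Γ s t :=
  have h := abs_lt.1 (hΓ.abs_angleCos_lt_one hj s t)
  Real.cos_arccos h.1.le h.2.le

lemma chordPhase_eq_iff (hΓ : IsOval M j l Γ) (hj : 1 ≤ j) {s t : ℝ} {c : Cyl l} :
    hΓ.chordPhase hj s t = c ↔ (s : AddCircle l) = c.1 ∧ angleCos M Γ s t = Real.cos c.2 := by
  constructor
  · rintro rfl
    exact ⟨rfl, (hΓ.cos_arccos_angleCos hj s t).symm⟩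
  · rintro ⟨h1, h2⟩
    refine Prod.ext h1 (Subtype.ext ?_)
    simp only [chordPhase, h2]
    exact Real.arccos_cos c.2.2.1.le c.2.2.2.le

lemma flip_chordPhase_eq_iff (hΓ : IsOval M j l Γ) (hj : 1 ≤ j) {s t : ℝ} {c : Cyl l} :
    flip (hΓ.chordPhase hj s t) = c ↔
      (s : AddCircle l) = c.1 ∧ -angleCos M Γ s t = Real.cos c.2 := by
  have : flip (hΓ.chordPhase hj s t) = c ↔ hΓ.chordPhase hj s t = flip c :=
    ⟨fun h => by rw [← h, flip_flip], fun h => by rw [h, flip_flip]⟩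
  rw [this, chordPhase_eq_iff]
  simp only [flip, Real.cos_pi_sub]
  rw [neg_eq_iff_eq_neg]

lemma step_iff_chordPhase (hΓ : IsOval M j l Γ) (hl : 0 < l) (hj : 1 ≤ j) (c c' : Cyl l) :
    Step M l Γ c c' ↔ ∃ s t : ℝ, Γ s ≠ Γ t ∧ hΓ.chordPhase hj s t = c ∧
      flip (hΓ.chordPhase hj t s) = c' := by
  rw [hΓ.step_iff hl hj]
  simp only [chordPhase_eq_iff, flip_chordPhase_eq_iff]
  constructor
  · rintro ⟨s, t, h1, h2, h3, h4, h5⟩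
    exact ⟨s, t, h3, ⟨h1, h4⟩, h2, h5⟩
  · rintro ⟨s, t, h3, ⟨h1, h4⟩, h2, h5⟩
    exact ⟨s, t, h1, h2, h3, h4, h5⟩

lemma exists_chordPhase (hΓ : IsOval M j l Γ) (hl : 0 < l) (hj : 1 ≤ j) (c : Cyl l) :
    ∃ s t : ℝ, Γ s ≠ Γ t ∧ hΓ.chordPhase hj s t = c := by
  obtain ⟨s, hs⟩ := QuotientAddGroup.mk_surjective c.1
  obtain ⟨t, hst, ht⟩ := hΓ.exists_chord hl hj s (cos_mem_Ioo c.2.2)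
  exact ⟨s, t, hst, (hΓ.chordPhase_eq_iff hj).2 ⟨hs, ht⟩⟩

lemma chordPhase_symm_eq (hΓ : IsOval M j l Γ) (hl : 0 < l) (hj : 1 ≤ j) {s t s' t' : ℝ}
    (h : Γ s ≠ Γ t) (h' : Γ s' ≠ Γ t') (e : hΓ.chordPhase hj s t = hΓ.chordPhase hj s' t') :
    hΓ.chordPhase hj t s = hΓ.chordPhase hj t' s' := by
  obtain ⟨e1, e2⟩ := (hΓ.chordPhase_eq_iff hj).1 e
  have e1 : (s : AddCircle l) = s' := e1
  have e2 : angleCos M Γ s t = angleCos M Γ s t' := by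
    rw [e2, hΓ.angleCos_congr e1 rfl]; exact hΓ.cos_arccos_angleCos hj s' t'
  have e3 := hΓ.coe_eq_coe_of_angleCos_eq hl hj h
    (by rw [(hΓ.apply_eq_iff hl).2 e1]; exact h') e2
  refine (hΓ.chordPhase_eq_iff hj).2 ⟨e3, ?_⟩
  rw [hΓ.angleCos_congr e3 e1]
  exact (hΓ.cos_arccos_angleCos hj t' s').symm

/-- A phase point has only one chord (`chordPhase_symm_eq`), so the choice in `billiardMap` can only
pick this value. -/
lemma billiardMap_chordPhase (hΓ : IsOval M j l Γ) (hl : 0 < l) (hj : 1 ≤ j) {s t : ℝ}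
    (h : Γ s ≠ Γ t) :
    billiardMap M l Γ (hΓ.chordPhase hj s t) = flip (hΓ.chordPhase hj t s) := by
  have hex : ∃ c', Step M l Γ (hΓ.chordPhase hj s t) c' :=
    ⟨_, (hΓ.step_iff_chordPhase hl hj _ _).2 ⟨s, t, h, rfl, rfl⟩⟩
  rw [billiardMap, dif_pos hex]
  obtain ⟨s', t', h', e, e'⟩ := (hΓ.step_iff_chordPhase hl hj _ _).1 hex.choose_spec
  rw [← e', hΓ.chordPhase_symm_eq hl hj h' h e]

lemma step_iff_billiardMap (hΓ : IsOval M j l Γ) (hl : 0 < l) (hj : 1 ≤ j) (c c' : Cyl l) :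
    Step M l Γ c c' ↔ billiardMap M l Γ c = c' := by
  rw [hΓ.step_iff_chordPhase hl hj]
  constructor
  · rintro ⟨s, t, h, rfl, rfl⟩
    exact hΓ.billiardMap_chordPhase hl hj h
  · rintro rfl
    obtain ⟨s, t, h, rfl⟩ := hΓ.exists_chordPhase hl hj c
    exact ⟨s, t, h, rfl, (hΓ.billiardMap_chordPhase hl hj h).symm⟩

lemma isReversible (hΓ : IsOval M j l Γ) (hl : 0 < l) (hj : 1 ≤ j) :
    IsReversible (billiardMap M l Γ) := by
  have key : ∀ c, flip (billiardMap M l Γ (flip (billiardMap M l Γ c))) = c := fun c => by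
    obtain ⟨s, t, h, rfl⟩ := hΓ.exists_chordPhase hl hj c
    rw [hΓ.billiardMap_chordPhase hl hj h, flip_flip, hΓ.billiardMap_chordPhase hl hj h.symm,
      flip_flip]
  refine ⟨key, fun c => ?_⟩
  have := key (flip c)
  simp only [Function.comp]
  rw [← flip_flip (billiardMap M l Γ _), this, flip_flip]

/-! ### Smoothness and twist -/

/-- The order `j - 1` is that of the velocity, the only derivative of `Γ` in the formula. -/
lemma contDiffAt_angleCos (hΓ : IsOval M j l Γ) (hj : 1 ≤ j) {s t : ℝ} (h : Γ s ≠ Γ t) :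
    ContDiffAt ℝ ((j - 1 : ℕ∞) : WithTop ℕ∞) (fun x : ℝ × ℝ => angleCos M Γ x.1 x.2) (s, t) := by
  set k : WithTop ℕ∞ := ((j - 1 : ℕ∞) : WithTop ℕ∞)
  have hΓk : ContDiff ℝ k Γ := hΓ.contDiff.of_le
    (WithTop.coe_le_coe.2 (tsub_le_self : j - 1 ≤ j))
  have hd : ContDiff ℝ k (deriv Γ) := hΓ.contDiff_deriv hj
  have hform : ∀ {f g : ℝ × ℝ → V}, ContDiff ℝ k f → ContDiff ℝ k g →
      ContDiff ℝ k fun x => form M (f x) (g x) := fun hf hg => by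
    cases M <;> simp only [form] <;> fun_prop
  have hp : ContDiff ℝ k fun x : ℝ × ℝ => Γ x.1 := hΓk.comp contDiff_fst
  have he : ContDiff ℝ k fun x : ℝ × ℝ => deriv Γ x.1 := hd.comp contDiff_fst
  have hq : ContDiff ℝ k fun x : ℝ × ℝ => Γ x.2 := hΓk.comp contDiff_snd
  have hlev : ContDiff ℝ k fun x : ℝ × ℝ => levelForm M (Γ x.1) (Γ x.2) := by
    cases M <;> simp only [levelForm] <;> fun_prop
  have hN : ContDiff ℝ k fun x : ℝ × ℝ => toward M (Γ x.1) (Γ x.2) := hq.sub (hlev.smul hp)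
  have hR := towardSq_pos (hΓ.mem_surface s) (hΓ.mem_surface t) h
  exact (hform hN he).contDiffAt.div ((hform hN hN).contDiffAt.sqrt hR.ne')
    (Real.sqrt_pos.2 hR).ne'

lemma contDiffAt_arccos_angleCos (hΓ : IsOval M j l Γ) (hj : 1 ≤ j) {s t : ℝ} (h : Γ s ≠ Γ t) :
    ContDiffAt ℝ ((j - 1 : ℕ∞) : WithTop ℕ∞)
      (fun x : ℝ × ℝ => Real.arccos (angleCos M Γ x.1 x.2)) (s, t) := by
  have h1 := abs_lt.1 (hΓ.abs_angleCos_lt_one hj s t)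
  exact ContDiffAt.comp (g := Real.arccos) (f := fun x : ℝ × ℝ => angleCos M Γ x.1 x.2) (s, t)
    (Real.contDiffAt_arccos h1.1.ne' h1.2.ne) (hΓ.contDiffAt_angleCos hj h)

lemma hasDerivAt_arccos_angleCos (hΓ : IsOval M j l Γ) (hj : 1 ≤ j) {s t : ℝ} (h : Γ s ≠ Γ t) :
    HasDerivAt (fun y => Real.arccos (angleCos M Γ s y))
      (chordDensity M Γ s t / √(1 - angleCos M Γ s t ^ 2)) t := by
  have h1 := abs_lt.1 (hΓ.abs_angleCos_lt_one hj s t)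
  exact ((Real.hasDerivAt_arccos h1.1.ne' h1.2.ne).comp t
    (hΓ.hasDerivAt_angleCos hj h)).congr_deriv (by ring)

lemma sqrt_one_sub_angleCos_sq_pos (hΓ : IsOval M j l Γ) (hj : 1 ≤ j) (s t : ℝ) :
    0 < √(1 - angleCos M Γ s t ^ 2) :=
  Real.sqrt_pos.2 (sub_pos.2 ((sq_lt_one_iff_abs_lt_one _).2 (hΓ.abs_angleCos_lt_one hj s t)))

end IsOval

/-- A skew map of the plane over the identity has a smooth local right inverse where its second
component has nonzero partial derivative. -/
lemma exists_local_inverse_skew {k : WithTop ℕ∞} (hk : k ≠ 0) {f : ℝ × ℝ → ℝ} {s t d : ℝ}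
    (hf : ContDiffAt ℝ k f (s, t)) (hd : HasDerivAt (fun y => f (s, y)) d t) (hd0 : d ≠ 0) :
    ∃ g : ℝ × ℝ → ℝ, ContDiffAt ℝ k g (s, f (s, t)) ∧ g (s, f (s, t)) = t ∧
      ∀ᶠ q in 𝓝 (s, f (s, t)), f (q.1, g q) = q.2 := by
  set Φ : ℝ × ℝ → ℝ × ℝ := fun x => (x.1, f x)
  have hΦ : ContDiffAt ℝ k Φ (s, t) := contDiffAt_fst.prodMk hf
  have hfd : HasFDerivAt f (fderiv ℝ f (s, t)) (s, t) := (hf.differentiableAt hk).hasFDerivAt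
  have hΦd : HasFDerivAt Φ ((ContinuousLinearMap.fst ℝ ℝ ℝ).prod (fderiv ℝ f (s, t))) (s, t) :=
    hasFDerivAt_fst.prodMk hfd
  have hpart : fderiv ℝ f (s, t) (0, 1) = d := by
    have h1 : HasDerivAt (fun y : ℝ => (s, y)) ((0 : ℝ), (1 : ℝ)) t :=
      (hasDerivAt_const t s).prodMk (hasDerivAt_id t)
    exact (hfd.comp_hasDerivAt t h1).unique hd
  have hinj : Function.Injective
      (((ContinuousLinearMap.fst ℝ ℝ ℝ).prod (fderiv ℝ f (s, t)) : ℝ × ℝ →L[ℝ] ℝ × ℝ) :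
        ℝ × ℝ →ₗ[ℝ] ℝ × ℝ) := by
    rw [← LinearMap.ker_eq_bot, LinearMap.ker_eq_bot']
    rintro ⟨x, y⟩ hxy
    have h1 : x = 0 := congrArg Prod.fst hxy
    have h2 : fderiv ℝ f (s, t) (x, y) = 0 := congrArg Prod.snd hxy
    have e : ((x, y) : ℝ × ℝ) = y • (0, 1) := by simp [h1]
    rw [e, map_smul, hpart, smul_eq_mul] at h2
    rw [h1, (mul_eq_zero.1 h2).resolve_right hd0]
    rfl
  let e : (ℝ × ℝ) ≃L[ℝ] ℝ × ℝ := (LinearEquiv.ofInjectiveEndo _ hinj).toContinuousLinearEquiv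
  have he : HasFDerivAt Φ (e : ℝ × ℝ →L[ℝ] ℝ × ℝ) (s, t) :=
    hΦd.congr_fderiv (ContinuousLinearMap.ext fun x => rfl)
  have hinv := hΦ.to_localInverse he hk
  have hev := (hΦ.hasStrictFDerivAt' he hk).eventually_right_inverse
  refine ⟨fun q => (hΦ.localInverse he hk q).2, contDiffAt_snd.comp _ hinv,
    congrArg Prod.snd (hΦ.localInverse_apply_image he hk), ?_⟩
  filter_upwards [hev] with q hq
  replace hq : Φ (hΦ.localInverse he hk q) = q := hq
  have h1 : (hΦ.localInverse he hk q).1 = q.1 := (Prod.ext_iff.1 hq).1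
  have h2 : f (hΦ.localInverse he hk q) = q.2 := (Prod.ext_iff.1 hq).2
  rw [← h1]
  exact h2

namespace IsOval

/-- The implicit solution `g (s, ψ)` is the next impact, and the next angle is `π` minus the angle
of the reversed chord. The bound `2 ≤ j` leaves one derivative for the inverse function theorem. -/
lemma exists_lift (hΓ : IsOval M j l Γ) (hl : 0 < l) (hj : 2 ≤ j) (s : ℝ) {ψ : ℝ}
    (hψ : ψ ∈ Ioo 0 Real.pi) :
    ∃ F : ℝ × ℝ → ℝ × ℝ, IsLocalLiftAt (billiardMap M l Γ) F (s, ψ) ∧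
      ContDiffAt ℝ ((j - 1 : ℕ∞) : WithTop ℕ∞) F (s, ψ) ∧
      deriv (fun u => (F (s, u)).1) ψ ≠ 0 := by
  have hj1 : 1 ≤ j := one_le_two.trans hj
  have hk : ((j - 1 : ℕ∞) : WithTop ℕ∞) ≠ 0 := by
    intro h
    have h : j - 1 = 0 := by exact_mod_cast h
    have : j ≤ 1 := tsub_eq_zero_iff_le.1 h
    exact absurd (hj.trans this) (by decide)
  obtain ⟨t, hst, ht⟩ := hΓ.exists_chord hl hj1 s (cos_mem_Ioo hψ)
  have harc : Real.arccos (angleCos M Γ s t) = ψ := by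
    rw [ht, Real.arccos_cos hψ.1.le hψ.2.le]
  have hd := hΓ.hasDerivAt_arccos_angleCos hj1 hst
  have hd0 := (div_pos (hΓ.chordDensity_pos hl hj1 hst)
    (hΓ.sqrt_one_sub_angleCos_sq_pos hj1 s t)).ne'
  obtain ⟨g, hg, hgt, hev⟩ := exists_local_inverse_skew hk
    (hΓ.contDiffAt_arccos_angleCos hj1 hst) hd hd0
  simp only [harc] at hg hgt hev
  refine ⟨fun q => (g q, Real.pi - Real.arccos (angleCos M Γ (g q) q.1)), ?_, ?_, ?_⟩
  · have hne : ∀ᶠ q : ℝ × ℝ in 𝓝 (s, ψ), Γ q.1 ≠ Γ (g q) := by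
      have h1 : ContinuousAt (fun q : ℝ × ℝ => Γ q.1) (s, ψ) :=
        (hΓ.continuous.comp continuous_fst).continuousAt
      have h2 : ContinuousAt (fun q : ℝ × ℝ => Γ (g q)) (s, ψ) :=
        hΓ.continuous.continuousAt.comp hg.continuousAt
      exact (h1.ne_iff_eventually_ne h2).1 (by simpa [hgt] using hst)
    filter_upwards [hev, hne] with q hq hqne hq2
    have e : hΓ.chordPhase hj1 q.1 (g q) = ((q.1 : AddCircle l), ⟨q.2, hq2⟩) :=
      Prod.ext rfl (Subtype.ext hq)
    rw [← e, hΓ.billiardMap_chordPhase hl hj1 hqne]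
    exact ⟨rfl, rfl⟩
  · have h1 : ContDiffAt ℝ ((j - 1 : ℕ∞) : WithTop ℕ∞)
        (fun x : ℝ × ℝ => Real.arccos (angleCos M Γ x.1 x.2)) (g (s, ψ), s) := by
      rw [hgt]; exact hΓ.contDiffAt_arccos_angleCos hj1 hst.symm
    exact hg.prodMk (contDiffAt_const.sub (ContDiffAt.comp
      (g := fun x : ℝ × ℝ => Real.arccos (angleCos M Γ x.1 x.2)) (f := fun q => (g q, q.1)) (s, ψ) h1
      (hg.prodMk contDiffAt_fst)))
  -- Differentiating `arccos (angleCos M Γ s (g (s, u))) = u` in `u` shows that `∂g/∂u` cannot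
  -- vanish.
  · intro h0
    have hc : ContinuousAt (fun u : ℝ => (s, u)) ψ := by fun_prop
    have hgd : DifferentiableAt ℝ (fun u => g (s, u)) ψ :=
      (hg.differentiableAt hk).comp ψ ((differentiableAt_const s).prodMk differentiableAt_id)
    have hgd' : HasDerivAt (fun u => g (s, u)) 0 ψ := h0 ▸ hgd.hasDerivAt
    rw [← hgt] at hd
    have h1 := hd.comp ψ hgd'
    rw [mul_zero] at h1
    have h2 : HasDerivAt (fun u : ℝ => u) 0 ψ :=
      h1.congr_of_eventuallyEq ((hc.eventually hev).mono fun u hu => hu.symm)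
    exact zero_ne_one (h2.unique (hasDerivAt_id ψ))

lemma isTwist (hΓ : IsOval M j l Γ) (hl : 0 < l) (hj : 2 ≤ j) : IsTwist (billiardMap M l Γ) := by
  intro s ψ hψ
  obtain ⟨F, h1, h2, h3⟩ := hΓ.exists_lift hl hj s hψ
  refine ⟨F, h1, h2.of_le ?_, h3⟩
  have : 1 ≤ j - 1 := by
    have := tsub_le_tsub_right hj 1
    exact this
  exact_mod_cast this

lemma isCk (hΓ : IsOval M j l Γ) (hl : 0 < l) (hj : 2 ≤ j) : IsCk (j - 1) (billiardMap M l Γ) := by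
  intro s ψ hψ
  obtain ⟨F, h1, h2, -⟩ := hΓ.exists_lift hl hj s hψ
  exact ⟨F, h1, h2⟩

end IsOval

lemma IsCk.flip_comp_comp_flip {k : ℕ∞} {T : Cyl l → Cyl l} (hT : IsCk k T) :
    IsCk k (flip ∘ T ∘ flip) := by
  intro s ψ hψ
  obtain ⟨F, h1, h2⟩ := hT s (Real.pi - ψ) ⟨by linarith [hψ.2], by linarith [hψ.1]⟩
  have hc : Continuous fun q : ℝ × ℝ => (q.1, Real.pi - q.2) := by fun_prop
  have hd : ContDiff ℝ k fun q : ℝ × ℝ => (q.1, Real.pi - q.2) := by fun_prop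
  refine ⟨fun q => ((F (q.1, Real.pi - q.2)).1, Real.pi - (F (q.1, Real.pi - q.2)).2), ?_, ?_⟩
  · filter_upwards [(hc.tendsto (s, ψ)).eventually h1] with q hq hq2
    obtain ⟨e1, e2⟩ := hq ⟨by linarith [hq2.2], by linarith [hq2.1]⟩
    exact ⟨e1, congrArg (Real.pi - ·) e2⟩
  · exact hd.contDiffAt.comp (s, ψ)
      (ContDiffAt.comp (g := F) (f := fun q : ℝ × ℝ => (q.1, Real.pi - q.2)) (s, ψ) h2 hd.contDiffAt)

lemma IsOval.isCkDiffeo (hΓ : IsOval M j l Γ) (hl : 0 < l) (hj : 2 ≤ j) :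
    IsCkDiffeo (j - 1) (billiardMap M l Γ) :=
  have h := hΓ.isReversible hl (one_le_two.trans hj)
  ⟨_, h.1, h.2, hΓ.isCk hl hj, (hΓ.isCk hl hj).flip_comp_comp_flip⟩

end
/-! ### The invariant measure -/

open Classical in
/-- The retraction of `ℝ` to `(0, π)` that is constant outside the interval. -/
noncomputable def toIoo (ψ : ℝ) : Ioo (0 : ℝ) Real.pi :=
  if h : ψ ∈ Ioo (0 : ℝ) Real.pi then ⟨ψ, h⟩
  else ⟨Real.pi / 2, by constructor <;> linarith [Real.pi_pos]⟩

lemma toIoo_of_mem {ψ : ℝ} (h : ψ ∈ Ioo (0 : ℝ) Real.pi) : toIoo ψ = ⟨ψ, h⟩ := dif_pos h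

section
variable {M : Model} {j : ℕ∞} {l : ℝ} {Γ : ℝ → V}

lemma lintegral_cylMeasure [Fact (0 < l)] {f : Cyl l → ENNReal} (hf : Measurable f) :
    ∫⁻ c, f c ∂cylMeasure l =
      ∫⁻ x : AddCircle l, ∫⁻ ψ in Ioo 0 Real.pi, f (x, toIoo ψ) * ENNReal.ofReal (Real.sin ψ) := by
  have hsin : Measurable fun c : Cyl l => ENNReal.ofReal (Real.sin c.2) := by fun_prop
  -- Needed for Fubini; inherited from the push-forward to `ℝ`, a restriction of Lebesgue measure.
  have : SFinite (Measure.comap ((↑) : Ioo (0 : ℝ) Real.pi → ℝ) volume) := by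
    have h : SigmaFinite (Measure.map ((↑) : Ioo (0 : ℝ) Real.pi → ℝ)
        (Measure.comap ((↑) : Ioo (0 : ℝ) Real.pi → ℝ) volume)) := by
      rw [map_comap_subtype_coe measurableSet_Ioo]; infer_instance
    have := SigmaFinite.of_map _ measurable_subtype_coe.aemeasurable h
    infer_instance
  rw [cylMeasure, lintegral_withDensity_eq_lintegral_mul _ hsin hf,
    lintegral_prod _ (hsin.mul hf).aemeasurable]
  refine lintegral_congr fun x => ?_
  rw [← lintegral_subtype_comap measurableSet_Ioo]
  refine lintegral_congr fun ψ => ?_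
  rw [toIoo_of_mem ψ.2, mul_comm]
  rfl

lemma lintegral_flip [Fact (0 < l)] {f : Cyl l → ENNReal} (hf : Measurable f) :
    ∫⁻ c, f (flip c) ∂cylMeasure l = ∫⁻ c, f c ∂cylMeasure l := by
  have hflip : Measurable (flip : Cyl l → Cyl l) :=
    measurable_fst.prodMk (Measurable.subtype_mk (by fun_prop))
  rw [lintegral_cylMeasure hf]
  refine (lintegral_cylMeasure (hf.comp hflip)).trans ?_
  refine lintegral_congr fun x => ?_
  have h := lintegral_image_eq_lintegral_abs_deriv_mul (s := Ioo 0 Real.pi) measurableSet_Ioo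
    (fun ψ _ => ((hasDerivAt_id ψ).const_sub Real.pi).hasDerivWithinAt)
    (fun a _ b _ h => sub_right_injective h)
    (fun ψ => f (x, toIoo ψ) * ENNReal.ofReal (Real.sin ψ))
  simp only [id, image_const_sub_Ioo, sub_self, sub_zero, abs_neg, abs_one, ENNReal.ofReal_one,
    one_mul, Real.sin_pi_sub] at h
  rw [h]
  refine setLIntegral_congr_fun measurableSet_Ioo fun ψ hψ => ?_
  have hψ' : Real.pi - ψ ∈ Ioo 0 Real.pi := ⟨by linarith [hψ.2], by linarith [hψ.1]⟩
  simp only [toIoo_of_mem hψ, toIoo_of_mem hψ', Function.comp, flip]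

namespace IsOval

lemma image_arccos_angleCos (hΓ : IsOval M j l Γ) (hl : 0 < l) (hj : 1 ≤ j) (s : ℝ) :
    (fun t => Real.arccos (angleCos M Γ s t)) '' Ioo s (s + l) = Ioo 0 Real.pi := by
  rw [← image_image Real.arccos, hΓ.image_angleCos hl hj]
  apply Subset.antisymm
  · rintro _ ⟨y, hy, rfl⟩
    exact ⟨Real.arccos_pos.2 hy.2, (Real.arccos_le_pi _).lt_of_ne fun h =>
      hy.1.not_ge (Real.arccos_eq_pi.1 h)⟩
  · intro ψ hψ
    exact ⟨Real.cos ψ, cos_mem_Ioo hψ, Real.arccos_cos hψ.1.le hψ.2.le⟩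

/-- Substitute `ψ = arccos (angleCos M Γ s t)`: the factor `sin ψ` cancels the root in the
derivative of `arccos`. -/
lemma lintegral_angle (hΓ : IsOval M j l Γ) (hl : 0 < l) (hj : 1 ≤ j) (s : ℝ) (G : ℝ → ENNReal) :
    ∫⁻ ψ in Ioo 0 Real.pi, G ψ * ENNReal.ofReal (Real.sin ψ) =
      ∫⁻ t in Ioo s (s + l), G (Real.arccos (angleCos M Γ s t)) *
        ENNReal.ofReal (chordDensity M Γ s t) := by
  have hinj : InjOn (fun t => Real.arccos (angleCos M Γ s t)) (Ioo s (s + l)) := by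
    intro t ht t' ht' e
    refine (hΓ.strictAntiOn_angleCos hl hj s).injOn ht ht' ?_
    rw [← hΓ.cos_arccos_angleCos hj, ← hΓ.cos_arccos_angleCos hj s t']
    exact congrArg Real.cos e
  rw [← hΓ.image_arccos_angleCos hl hj s, lintegral_image_eq_lintegral_abs_deriv_mul
    measurableSet_Ioo (fun t ht => (hΓ.hasDerivAt_arccos_angleCos hj
      (hΓ.apply_ne_of_mem_Ioo ht)).hasDerivWithinAt) hinj]
  refine setLIntegral_congr_fun measurableSet_Ioo fun t ht => ?_
  have h1 := hΓ.chordDensity_pos hl hj (hΓ.apply_ne_of_mem_Ioo ht)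
  have h2 := hΓ.sqrt_one_sub_angleCos_sq_pos hj s t
  rw [Real.sin_arccos, mul_left_comm, abs_of_pos (div_pos h1 h2),
    ← ENNReal.ofReal_mul (div_pos h1 h2).le, div_mul_cancel₀ _ h2.ne']

lemma chordPhase_congr (hΓ : IsOval M j l Γ) (hj : 1 ≤ j) {s t s' t' : ℝ}
    (hs : (s : AddCircle l) = s') (ht : (t : AddCircle l) = t') :
    hΓ.chordPhase hj s t = hΓ.chordPhase hj s' t' := by
  refine Prod.ext hs (Subtype.ext ?_)
  simp only [chordPhase, hΓ.angleCos_congr hs ht]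

lemma lintegral_cylMeasure_eq_chords (hΓ : IsOval M j l Γ) [hl : Fact (0 < l)] (hj : 1 ≤ j)
    {f : Cyl l → ENNReal} (hf : Measurable f) :
    ∫⁻ c, f c ∂cylMeasure l = ∫⁻ s in Ioc 0 (0 + l), ∫⁻ t in Ioc 0 (0 + l),
      f (hΓ.chordPhase hj s t) * ENNReal.ofReal (chordDensity M Γ s t) := by
  rw [lintegral_cylMeasure hf, ← AddCircle.lintegral_preimage l 0]
  refine lintegral_congr fun s => ?_
  rw [hΓ.lintegral_angle hl.out hj s (fun ψ => f ((s : AddCircle l), toIoo ψ)),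
    setLIntegral_congr (Ioo_ae_eq_Ioc)]
  -- Periodicity moves the inner integral from `(s, s + l)` to a period independent of `s`, so that
  -- the two integrals can later be exchanged.
  have hper : Function.Periodic (fun t => f (hΓ.chordPhase hj s t) *
      ENNReal.ofReal (chordDensity M Γ s t)) l := fun t => by
    simp only [hΓ.periodic_chordDensity s t]
    rw [hΓ.chordPhase_congr hj rfl (t' := t) (by
      rw [AddCircle.coe_add, AddCircle.coe_period, add_zero])]
  have e : ∀ t, f ((s : AddCircle l), toIoo (Real.arccos (angleCos M Γ s t))) =
      f (hΓ.chordPhase hj s t) := fun t => by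
    exact congrArg (fun y => f ((s : AddCircle l), y)) (toIoo_of_mem (hΓ.chordPhase hj s t).2.2)
  simp only [e]
  exact (AddCircle.lintegral_preimage l s hper.lift).trans
    (AddCircle.lintegral_preimage l 0 hper.lift).symm

lemma measurable_chordPhase (hΓ : IsOval M j l Γ) [Fact (0 < l)] (hj : 1 ≤ j) :
    Measurable fun x : ℝ × ℝ => hΓ.chordPhase hj x.1 x.2 := by
  have h1 := hΓ.continuous
  have h2 := hΓ.continuous_deriv hj
  have hform : ∀ {f g : ℝ × ℝ → V}, Continuous f → Continuous g →
      Continuous fun x => form M (f x) (g x) := fun hf hg => by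
    cases M <;> simp only [form] <;> fun_prop
  have hlev : Continuous fun x : ℝ × ℝ => levelForm M (Γ x.1) (Γ x.2) := by
    cases M <;> simp only [levelForm] <;> fun_prop
  have hN : Continuous fun x : ℝ × ℝ => toward M (Γ x.1) (Γ x.2) := by
    unfold toward; fun_prop
  have hC : Measurable fun x : ℝ × ℝ => angleCos M Γ x.1 x.2 :=
    (hform hN (h2.comp continuous_fst)).measurable.div (hform hN hN).sqrt.measurable
  exact ((AddCircle.continuous_mk' l).measurable.comp measurable_fst).prodMk
    (Measurable.subtype_mk (Real.continuous_arccos.measurable.comp hC))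

lemma measurable_chordDensity (hΓ : IsOval M j l Γ) (hj : 1 ≤ j) :
    Measurable fun x : ℝ × ℝ => chordDensity M Γ x.1 x.2 := by
  have h1 := hΓ.continuous
  have h2 := hΓ.continuous_deriv hj
  have hW : Continuous fun x : ℝ × ℝ => height Γ x.1 x.2 * height Γ x.2 x.1 := by
    simp only [height, triple]; fun_prop
  have hlev : Continuous fun x : ℝ × ℝ => levelForm M (Γ x.1) (Γ x.2) := by
    cases M <;> simp only [levelForm] <;> fun_prop
  have hN : Continuous fun x : ℝ × ℝ => toward M (Γ x.1) (Γ x.2) := by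
    unfold toward; fun_prop
  have hR : Continuous fun x : ℝ × ℝ => towardSq M (Γ x.1) (Γ x.2) := by
    simp only [towardSq]
    cases M <;> simp only [form] <;> fun_prop
  exact hW.measurable.div (hR.sqrt.pow 3).measurable

/-- In chord coordinates the claim is Tonelli's theorem for a symmetric density; the remaining flip
preserves the measure by `lintegral_flip`. -/
lemma measurePreserving (hΓ : IsOval M j l Γ) [hl : Fact (0 < l)] (hj : 1 ≤ j)
    (hT : Measurable (billiardMap M l Γ)) :
    MeasurePreserving (billiardMap M l Γ) (cylMeasure l) (cylMeasure l) := by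
  have hflip : Measurable (flip : Cyl l → Cyl l) :=
    measurable_fst.prodMk (Measurable.subtype_mk (by fun_prop))
  refine ⟨hT, Measure.ext_of_lintegral _ fun f hf => ?_⟩
  rw [lintegral_map hf hT, ← lintegral_flip hf]
  refine (hΓ.lintegral_cylMeasure_eq_chords hj (hf.comp hT)).trans
    (Eq.trans ?_ (hΓ.lintegral_cylMeasure_eq_chords hj (hf.comp hflip)).symm)
  have e : ∀ s t, (f ∘ billiardMap M l Γ) (hΓ.chordPhase hj s t) *
      ENNReal.ofReal (chordDensity M Γ s t) =
      (f ∘ flip) (hΓ.chordPhase hj t s) * ENNReal.ofReal (chordDensity M Γ t s) := fun s t => by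
    -- On degenerate chords, where the formula for the billiard map is not available, both densities
    -- vanish.
    by_cases h : Γ s = Γ t
    · rw [chordDensity_eq_zero h, chordDensity_eq_zero h.symm]; simp
    · rw [Function.comp, hΓ.billiardMap_chordPhase hl.out hj h, hΓ.chordDensity_comm]; rfl
  simp only [e]
  refine lintegral_lintegral_swap (Measurable.aemeasurable ?_)
  exact (((hf.comp hflip).comp (hΓ.measurable_chordPhase hj)).mul
    (hΓ.measurable_chordDensity hj).ennreal_ofReal).comp measurable_swap

end IsOval

/-- The covering of the cylinder by the strip is open, so continuity can be tested upstairs on a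
local lift. This supplies the measurability of the billiard map. -/
lemma IsCk.continuous {k : ℕ∞} {T : Cyl l → Cyl l} (hT : IsCk k T) : Continuous T := by
  refine continuous_iff_continuousAt.2 fun ⟨x, ψ, hψ⟩ => ?_
  obtain ⟨s, rfl⟩ := QuotientAddGroup.mk_surjective x
  obtain ⟨F, hF, hFc⟩ := hT s ψ hψ
  have hFc := hFc.continuousAt
  let π : ℝ × Ioo (0 : ℝ) Real.pi → Cyl l := fun q => ((q.1 : AddCircle l), q.2)
  let q₀ : ℝ × Ioo (0 : ℝ) Real.pi := (s, ⟨ψ, hψ⟩)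
  have hmap : 𝓝 (π q₀) ≤ map π (𝓝 q₀) :=
    ((QuotientAddGroup.isOpenMap_coe).prodMap IsOpenMap.id).nhds_le q₀
  refine Tendsto.mono_left (tendsto_map'_iff.2 ?_) hmap
  have hι : Continuous fun q : ℝ × Ioo (0 : ℝ) Real.pi => (q.1, (q.2 : ℝ)) := by fun_prop
  have hev := (hι.tendsto q₀).eventually hF
  have hcomp : ContinuousAt (fun q : ℝ × Ioo (0 : ℝ) Real.pi => F (q.1, (q.2 : ℝ))) q₀ :=
    ContinuousAt.comp (g := F) hFc hι.continuousAt
  change ContinuousAt (T ∘ π) q₀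
  refine ContinuousAt.prodMk (f := fun q => (T (π q)).1) (g := fun q => (T (π q)).2) ?_ ?_
  · have h1 : ContinuousAt (fun q : ℝ × Ioo (0 : ℝ) Real.pi =>
        ((F (q.1, (q.2 : ℝ))).1 : AddCircle l)) q₀ :=
      (AddCircle.continuous_mk' l).continuousAt.comp hcomp.fst
    exact h1.congr (hev.mono fun q hq => (hq q.2.2).1)
  · refine Topology.IsInducing.subtypeVal.continuousAt_iff.2 ?_
    exact hcomp.snd.congr (hev.mono fun q hq => (hq q.2.2).2)

end
end OvalBilliard

theorem mainTheorem1 (M : OvalBilliard.Model) (j : ℕ∞) (hj : 2 ≤ j) (l : ℝ) [Fact (0 < l)]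
    (Γ : ℝ → OvalBilliard.V) (hΓ : OvalBilliard.IsOval M j l Γ) :
    (∀ c c' : OvalBilliard.Cyl l,
        OvalBilliard.Step M l Γ c c' ↔ OvalBilliard.billiardMap M l Γ c = c') ∧
      OvalBilliard.IsCkDiffeo (j - 1) (OvalBilliard.billiardMap M l Γ) ∧
      OvalBilliard.IsReversible (OvalBilliard.billiardMap M l Γ) ∧
      OvalBilliard.IsTwist (OvalBilliard.billiardMap M l Γ) ∧
      MeasurePreserving (OvalBilliard.billiardMap M l Γ)
        (OvalBilliard.cylMeasure l) (OvalBilliard.cylMeasure l) := by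
  have hl : 0 < l := Fact.out
  have hj1 : 1 ≤ j := one_le_two.trans hj
  exact ⟨hΓ.step_iff_billiardMap hl hj1, hΓ.isCkDiffeo hl hj, hΓ.isReversible hl hj1,
    hΓ.isTwist hl hj, hΓ.measurePreserving hj1 (hΓ.isCk hl hj).continuous.measurable⟩
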